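/- For graphs $G_1,\dots,G_d$ with anchor sets $S_j\subseteq V(G_j)$, the anchored product $(G_1,S_1)\boxplus\cdots\boxplus(G_d,S_d)$ is the graph whose vertices are the tuples $(v_1,\dots,v_d)\in V(G_1)\times\cdots\times V(G_d)$ with at most one coordinate $v_j\notin S_j$, two vertices being adjacent when they differ in exactly one coordinate $j$, their $j$-th coordinates are adjacent in $G_j$, and all other (common) coordinates $v_k$ lie in $S_k$. (Up to isomorphism the order of the factors does not matter.) A graph $H$ decomposes $G$ if $G$ is the union of finitely many pairwise edge-disjoint subgraphs, each isomorphic to $H$. $C_b$ is the cycle of length $b$. Let $d\ge 2$ and let $a=2^{i_1}+2^{i_2}+\cdots+2^{i_d}$ be odd with integers $i_1>i_2>\cdots>i_d=0$. For $1\le j\le d$ let $y_j^*\ge 4$ be a power of two such that $z_j:=y_j^*2^{-i_j}$ is an even integer, and let $S_j$ consist of every $2^{i_j}$-th vertex of $C_{y_j^*}$ (so $S_d=V(C_{y_d^*})$). For $1\le k\le d$ put $$\alpha_k=\sum_{j=1}^{k-1}\log_2 z_j+\log_2 z_d-(k-1),$$ and let $\alpha$ be an integer with $\alpha_1\le\alpha\le\alpha_d$.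 Write $\eta(y,c)=1$ if $y>c$ and $\eta(y,c)=0$ otherwise, $\eta_{\alpha_k}=\eta(\alpha,\alpha_k)$, $A_2=\eta(\alpha+1,\alpha_2)$, $$A_3=2^{(1-A_2)(\alpha-\alpha_1)+A_2(\alpha_2-\alpha_1)+1},\qquad A_k=2^{(1-\eta_{\alpha_{k-1}})(\alpha-\alpha_{k-2})\eta_{\alpha_{k-2}}+\eta_{\alpha_{k-1}}(\alpha_{k-1}-\alpha_{k-2})}\quad(4\le k\le d+1).$$ Suppose that $4\mid y_d^*$, that $A_3 2^{i_1}\mid y_1^*$, and that $A_{j+2}2^{i_j+1}\mid y_j^*$ for all $2\le j\le d-1$ (no condition of this last kind when $d=2$). Then $C_{a\cdot 2^\alpha}$ decomposes $(C_{y_1^*},S_1)\boxplus(C_{y_d^*},S_d)$ when $d=2$, and $(C_{y_1^*},S_1)\boxplus(C_{y_d^*},S_d)\boxplus\cdots\boxplus(C_{y_2^*},S_2)$ when $d\ge3$. -/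

import Mathlib

/-- The anchored product of two graphs `G₁`, `G₂` with anchor sets `S₁`, `S₂`: its vertices are the
pairs with at least one coordinate in the respective anchor set, and two vertices are adjacent when
they differ along an edge of one factor while the other coordinate is fixed and lies in its anchor
set. -/
def anchoredProd₂ {V₁ V₂ : Type} (G₁ : SimpleGraph V₁) (S₁ : Set V₁)
    (G₂ : SimpleGraph V₂) (S₂ : Set V₂) :
    SimpleGraph {p : V₁ × V₂ // p.1 ∈ S₁ ∨ p.2 ∈ S₂} where
  Adj p q := (G₁.Adj p.1.1 q.1.1 ∧ p.1.2 = q.1.2 ∧ p.1.2 ∈ S₂) ∨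
    (G₂.Adj p.1.2 q.1.2 ∧ p.1.1 = q.1.1 ∧ p.1.1 ∈ S₁)
  symm := ⟨by
    rintro p q (⟨h, e, m⟩ | ⟨h, e, m⟩)
    · exact Or.inl ⟨h.symm, e.symm, e ▸ m⟩
    · exact Or.inr ⟨h.symm, e.symm, e ▸ m⟩⟩
  loopless := ⟨by
    rintro p (⟨h, -, -⟩ | ⟨h, -, -⟩) <;> exact h.ne rfl⟩

/-- The vertices of an anchored product of several factors: tuples with at most one coordinate
outside its anchor set. -/
abbrev AnchoredVertex {ι : Type} {V : ι → Type} (S : ∀ j, Set (V j)) : Type :=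
  {v : ∀ j, V j // ∀ j k, j ≠ k → v j ∈ S j ∨ v k ∈ S k}

/-- The anchored product of a family of graphs `G j` with anchor sets `S j`: two vertices are
adjacent when they differ along an edge of one factor, while all other coordinates are fixed and lie
in their anchor sets. Up to isomorphism this is the iterated binary anchored product, in any order
of the factors, where the anchor set of a product is the product of the anchor sets; see
`anchoredProd_succ` and `anchoredProd_reindex`. -/
def anchoredProd {ι : Type} {V : ι → Type} (G : ∀ j, SimpleGraph (V j)) (S : ∀ j, Set (V j)) :
    SimpleGraph (AnchoredVertex S) where
  Adj u v := ∃ j, (G j).Adj (u.1 j) (v.1 j) ∧ ∀ k, k ≠ j → u.1 k = v.1 k ∧ u.1 k ∈ S k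
  symm := ⟨by
    rintro u v ⟨j, h, H⟩
    exact ⟨j, h.symm, fun k hk => ⟨(H k hk).1.symm, (H k hk).1 ▸ (H k hk).2⟩⟩⟩
  loopless := ⟨by
    rintro u ⟨j, h, -⟩
    exact h.ne rfl⟩

/-- Splitting off the first factor of an anchored product: what remains is a binary anchored
product, whose second factor carries the product of the remaining anchor sets. -/
theorem anchoredProd_succ {n : ℕ} {V : Fin (n + 1) → Type}
    (G : ∀ j, SimpleGraph (V j)) (S : ∀ j, Set (V j)) :
    Nonempty (anchoredProd G S ≃g
      anchoredProd₂ (G 0) (S 0)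
        (anchoredProd (fun j : Fin n => G j.succ) (fun j : Fin n => S j.succ))
        {v | ∀ j, v.1 j ∈ S j.succ}) := by
  refine ⟨⟨⟨fun v => ⟨(v.1 0, ⟨fun j => v.1 j.succ, fun j k h =>
      v.2 _ _ (fun e => h (Fin.succ_injective _ e))⟩), ?_⟩,
    fun p => ⟨Fin.cons p.1.1 p.1.2.1, ?_⟩, ?_, ?_⟩, ?_⟩⟩
  · by_cases h : v.1 0 ∈ S 0
    · exact Or.inl h
    · exact Or.inr fun j => (v.2 0 j.succ (Fin.succ_ne_zero j).symm).resolve_left h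
  · intro j k
    refine Fin.cases ?_ (fun j => ?_) j <;> refine Fin.cases ?_ (fun k => ?_) k
    · simp
    · intro _
      rcases p.2 with h | h
      · exact Or.inl (by simpa using h)
      · exact Or.inr (by simpa using h k)
    · intro _
      rcases p.2 with h | h
      · exact Or.inr (by simpa using h)
      · exact Or.inl (by simpa using h j)
    · intro h
      simpa using p.1.2.2 j k (fun e => h (e ▸ rfl))
  · intro v
    apply Subtype.ext
    funext j
    refine Fin.cases ?_ (fun j => ?_) j <;> simp
  · intro p
    apply Subtype.ext
    apply Prod.ext
    · simp
    · apply Subtype.ext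
      funext j
      simp
  · intro u v
    constructor
    · rintro (⟨h, e, m⟩ | ⟨⟨j, h, H⟩, e, m⟩)
      · refine ⟨0, h, fun k => Fin.cases (fun h => (h rfl).elim) (fun k _ => ?_) k⟩
        exact ⟨congrFun (congrArg Subtype.val e) k, m k⟩
      · refine ⟨j.succ, h, fun k => Fin.cases (fun _ => ⟨e, m⟩) (fun k hk => ?_) k⟩
        exact H k (fun e => hk (e ▸ rfl))
    · rintro ⟨j, h, H⟩
      revert h H
      refine Fin.cases ?_ (fun j => ?_) j
      · intro h H
        exact Or.inl ⟨h, Subtype.ext (funext fun k => (H k.succ (Fin.succ_ne_zero k)).1),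
          fun k => (H k.succ (Fin.succ_ne_zero k)).2⟩
      · intro h H
        exact Or.inr ⟨⟨j, h, fun k hk => H k.succ (fun e => hk (Fin.succ_injective _ e))⟩,
          H 0 (Fin.succ_ne_zero j).symm⟩

/-- The anchored product does not depend on the order of its factors. -/
theorem anchoredProd_reindex {ι κ : Type} (e : κ ≃ ι) {V : ι → Type}
    (G : ∀ j, SimpleGraph (V j)) (S : ∀ j, Set (V j)) :
    Nonempty (anchoredProd G S ≃g anchoredProd (fun k => G (e k)) (fun k => S (e k))) := by
  refine ⟨⟨(Equiv.piCongrLeft V e).symm.subtypeEquiv fun v => ?_, ?_⟩⟩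
  · constructor
    · intro h j k hjk
      exact h (e j) (e k) (fun h' => hjk (e.injective h'))
    · intro h j k hjk
      obtain ⟨j, rfl⟩ := e.surjective j
      obtain ⟨k, rfl⟩ := e.surjective k
      exact h j k (fun h' => hjk (h' ▸ rfl))
  · intro u v
    constructor
    · rintro ⟨j, h, H⟩
      refine ⟨e j, h, fun k hk => ?_⟩
      obtain ⟨k, rfl⟩ := e.surjective k
      exact H k (fun h' => hk (h' ▸ rfl))
    · rintro ⟨j, h, H⟩
      obtain ⟨j, rfl⟩ := e.surjective j
      exact ⟨j, h, fun k hk => H (e k) (fun h' => hk (e.injective h'))⟩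

/-- `H` decomposes `G`: finitely many subgraphs of `G`, each isomorphic to `H` and pairwise without
common edges, have union `G`. -/
def Decomposes {W V : Type} (H : SimpleGraph W) (G : SimpleGraph V) : Prop :=
  ∃ (k : ℕ) (F : Fin k → G.Subgraph), 0 < k ∧
    (∀ r, Nonempty (H ≃g (F r).coe)) ∧
    (∀ r s, r ≠ s → Disjoint (F r).edgeSet (F s).edgeSet) ∧
    (⨆ r, F r) = ⊤

/-- Every `m`-th vertex of the cycle of length `n`. -/
def everyNth (n m : ℕ) : Set (Fin n) := {v | m ∣ (v : ℕ)}

/-- The indicator `η(y, c)` of `y > c`. -/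
def etaInd (y c : ℕ) : ℕ := if c < y then 1 else 0

/-- `α_k = ∑_{j=1}^{k-1} log₂ z_j + log₂ z_d - (k - 1)`. When all `z_j` are powers of two that are at
least two and `1 ≤ k ≤ d`, the subtraction does not truncate. -/
def alphaMax (d : ℕ) (z : ℕ → ℕ) (k : ℕ) : ℕ :=
  (∑ j ∈ Finset.Icc 1 (k - 1), Nat.log 2 (z j)) + Nat.log 2 (z d) - (k - 1)

/-- `A_2 = η(α + 1, α_2)`. -/
def A2 (d : ℕ) (z : ℕ → ℕ) (α : ℕ) : ℕ := etaInd (α + 1) (alphaMax d z 2)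

/-- `A_3 = 2^{(1 - A_2)(α - α_1) + A_2 (α_2 - α_1) + 1}`. When the `z_j` are powers of two that are at
least two and `α_1 ≤ α`, no subtraction truncates. -/
def A3 (d : ℕ) (z : ℕ → ℕ) (α : ℕ) : ℕ :=
  2 ^ ((1 - A2 d z α) * (α - alphaMax d z 1) +
    A2 d z α * (alphaMax d z 2 - alphaMax d z 1) + 1)

/-- `A_k = 2^{(1 - η_{α_{k-1}}) (α - α_{k-2}) η_{α_{k-2}} + η_{α_{k-1}} (α_{k-1} - α_{k-2})}` for
`4 ≤ k`, where `η_{α_k} = η(α, α_k)`. When the `z_j` are powers of two that are at least two, a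
subtraction truncates only where it is multiplied by zero. -/
def AFactor (d : ℕ) (z : ℕ → ℕ) (α k : ℕ) : ℕ :=
  2 ^ ((1 - etaInd α (alphaMax d z (k - 1))) * (α - alphaMax d z (k - 2)) *
      etaInd α (alphaMax d z (k - 2)) +
    etaInd α (alphaMax d z (k - 1)) * (alphaMax d z (k - 1) - alphaMax d z (k - 2)))

/-! Call a decomposition into cycles of a common length anchored with spacing m if the anchors are
distributed over the cycles so that each cycle has one at exactly every m-th vertex. If G and H have
anchored decompositions, every edge of their anchored product lies in the product of exactly one
cycle of G with one cycle of H. Hence it suffices to decompose the anchored product of two cycles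
(`IsCycleDecomp.box_comp`), and if that decomposition is anchored, so is the resulting one
(`IsAnchored.box_comp`); the construction can then be iterated.

The anchored product of a cycle of length p * a with spacing a and a cycle of length q * b with
spacing b is, up to isolated vertices, the p by q torus grid with horizontal edges subdivided into a
pieces and vertical edges into b pieces. Closed curves on the grid with r horizontal and r vertical
steps become cycles of length r * (a + b). Such families of curves are encoded by two direction
fields, one for each colour (`IsTorusPattern`). A curve of one colour has only one way out of each
grid point, and a count of steps turns covering all edges into using each exactly once.

Three patterns are used: strips with r = p, spirals with r = p * q / 2, and serpents with r = p * 2N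
when 4 divides p and 4N divides q. Strips and spirals alternate horizontal and vertical steps, so
every (a + b)-th vertex is again an anchor. Serpents do not alternate, so they serve only for the
last multiplication.

The product is built from the factor d, whose spacing is 1 and whose length is the power of two with
exponent α_1. Multiplying by factor j adds 2^{i_j} to the spacing, which finally becomes a, and
raises the exponent of two by some number from 0 to log₂ z_j - 1. The total growth α - α_1 is at
most the sum of these maxima; it is split so that all factors but one grow by 0 or by the maximum,
and the exceptional one is multiplied last (`exists_eq_sum_erase_add`,
`cycleDecomposable_partialProd`). -/

/-! ### Anchored cycle decompositions and their composition. -/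

/-- Closed walks `c k` of length `ℓ`, without repeated vertices, that use every edge of `G` exactly
once. For `3 ≤ ℓ` they form a decomposition of `G` into cycles of length `ℓ`. -/
structure IsCycleDecomp {V K : Type} (G : SimpleGraph V) (ℓ : ℕ) (c : K → ZMod ℓ → V) : Prop where
  adj : ∀ k t, G.Adj (c k t) (c k (t + 1))
  inj : ∀ k, Function.Injective (c k)
  edge_inj : ∀ k t k' t', s(c k t, c k (t + 1)) = s(c k' t', c k' (t' + 1)) → k = k' ∧ t = t'
  edge_surj : ∀ u v, G.Adj u v → ∃ k t, s(c k t, c k (t + 1)) = s(u, v)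

/-- The vertices of `S` are distributed over the cycles `c k`, such that each cycle gets every
`m`-th of its vertices. -/
structure IsAnchored {V K : Type} (S : Set V) (ℓ m : ℕ) (c : K → ZMod ℓ → V) : Prop where
  mem : ∀ k t, m ∣ t.val → c k t ∈ S
  exists_time : ∀ v ∈ S, ∃ k t, m ∣ t.val ∧ c k t = v
  unique : ∀ k t k' t', m ∣ t.val → m ∣ t'.val → c k t = c k' t' → k = k' ∧ t = t'

/-- `G` decomposes into cycles of length `ℓ`. -/
def CycleDecomposable {V : Type} (G : SimpleGraph V) (ℓ : ℕ) : Prop :=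
  ∃ (K : Type) (_ : Finite K) (c : K → ZMod ℓ → V), IsCycleDecomp G ℓ c

/-- `G` with anchor set `S` decomposes into cycles of length `ℓ` in which every `m`-th vertex is
an anchor. -/
def AnchoredDecomposable {V : Type} (G : SimpleGraph V) (S : Set V) (ℓ m : ℕ) : Prop :=
  ∃ (K : Type) (_ : Finite K) (c : K → ZMod ℓ → V), IsCycleDecomp G ℓ c ∧ IsAnchored S ℓ m c

theorem AnchoredDecomposable.cycleDecomposable {V : Type} {G : SimpleGraph V} {S : Set V}
    {ℓ m : ℕ} (h : AnchoredDecomposable G S ℓ m) : CycleDecomposable G ℓ := by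
  obtain ⟨K, hK, c, hc, -⟩ := h
  exact ⟨K, hK, c, hc⟩

/-- The anchored product on the full product of the vertex sets. -/
def boxAnch {V W : Type} (G : SimpleGraph V) (S : Set V) (H : SimpleGraph W) (T : Set W) :
    SimpleGraph (V × W) where
  Adj p q := (G.Adj p.1 q.1 ∧ p.2 = q.2 ∧ p.2 ∈ T) ∨ (H.Adj p.2 q.2 ∧ p.1 = q.1 ∧ p.1 ∈ S)
  symm := ⟨by
    rintro p q (⟨h, e, m⟩ | ⟨h, e, m⟩)
    · exact Or.inl ⟨h.symm, e.symm, e ▸ m⟩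
    · exact Or.inr ⟨h.symm, e.symm, e ▸ m⟩⟩
  loopless := ⟨by
    rintro p (⟨h, -, -⟩ | ⟨h, -, -⟩) <;> exact h.ne rfl⟩

/-- The cycle on the residues modulo `ℓ`. -/
def cyc (ℓ : ℕ) : SimpleGraph (ZMod ℓ) where
  Adj x y := x ≠ y ∧ (y = x + 1 ∨ x = y + 1)
  symm := ⟨fun _ _ h => ⟨h.1.symm, h.2.symm⟩⟩
  loopless := ⟨fun _ h => h.1 rfl⟩

/-- The residues modulo `ℓ` whose representative is divisible by `m`. -/
def multiples (ℓ m : ℕ) : Set (ZMod ℓ) := {t | m ∣ t.val}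

/-- Injectivity is required only on a set `D` containing all non-isolated vertices: the full
products used below have isolated vertices, which `φ` may identify. -/
theorem IsCycleDecomp.map {V W K : Type} {G : SimpleGraph V} {H : SimpleGraph W} {ℓ : ℕ}
    {c : K → ZMod ℓ → V} (hc : IsCycleDecomp G ℓ c) (φ : V → W) (D : Set V)
    (hD : ∀ u v, G.Adj u v → u ∈ D) (hφ : Set.InjOn φ D)
    (hom : ∀ u v, G.Adj u v → H.Adj (φ u) (φ v))
    (lift : ∀ x y, H.Adj x y → ∃ u v, G.Adj u v ∧ φ u = x ∧ φ v = y) :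
    IsCycleDecomp H ℓ (fun k t => φ (c k t)) := by
  have hcD : ∀ k t, c k t ∈ D := fun k t => hD _ _ (hc.adj k t)
  refine ⟨fun k t => hom _ _ (hc.adj k t), fun k t t' h => hc.inj k (hφ (hcD k t) (hcD k t') h),
    fun k t k' t' h => hc.edge_inj k t k' t' ?_, fun x y h => ?_⟩
  · rw [Sym2.eq_iff] at h ⊢
    rcases h with ⟨h₁, h₂⟩ | ⟨h₁, h₂⟩
    · exact Or.inl ⟨hφ (hcD _ _) (hcD _ _) h₁, hφ (hcD _ _) (hcD _ _) h₂⟩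
    · exact Or.inr ⟨hφ (hcD _ _) (hcD _ _) h₁, hφ (hcD _ _) (hcD _ _) h₂⟩
  · obtain ⟨u, v, huv, rfl, rfl⟩ := lift x y h
    obtain ⟨k, t, hkt⟩ := hc.edge_surj u v huv
    exact ⟨k, t, by simpa using congrArg (Sym2.map φ) hkt⟩

theorem IsAnchored.map {V W K : Type} {S : Set V} {T : Set W} {ℓ m : ℕ} {c : K → ZMod ℓ → V}
    (hc : IsAnchored S ℓ m c) (φ : V → W) (hφ : Set.InjOn φ S) (hST : φ '' S = T) :
    IsAnchored T ℓ m (fun k t => φ (c k t)) := by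
  subst hST
  refine ⟨fun k t h => ⟨_, hc.mem k t h, rfl⟩, ?_, fun k t k' t' h h' e =>
    hc.unique k t k' t' h h' (hφ (hc.mem _ _ h) (hc.mem _ _ h') e)⟩
  rintro _ ⟨v, hv, rfl⟩
  obtain ⟨k, t, h, rfl⟩ := hc.exists_time v hv
  exact ⟨k, t, h, rfl⟩

section Composition

variable {V W K K' K'' : Type} {G : SimpleGraph V} {S : Set V} {H : SimpleGraph W} {T : Set W}
  {ℓ m ℓ' m' ℓ'' m'' : ℕ} {c : K → ZMod ℓ → V} {c' : K' → ZMod ℓ' → W}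
  {e : K'' → ZMod ℓ'' → ZMod ℓ × ZMod ℓ'}

theorem IsCycleDecomp.adj_of_cyc_adj (hc : IsCycleDecomp G ℓ c) (k : K) {x y : ZMod ℓ}
    (h : (cyc ℓ).Adj x y) : G.Adj (c k x) (c k y) := by
  rcases h.2 with rfl | rfl
  · exact hc.adj k x
  · exact (hc.adj k y).symm

theorem IsCycleDecomp.cyc_adj (hc : IsCycleDecomp G ℓ c) (k : K) (t : ZMod ℓ) :
    (cyc ℓ).Adj t (t + 1) :=
  ⟨fun h => (hc.adj k t).ne (congrArg (c k) h), Or.inl rfl⟩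

theorem IsCycleDecomp.eq_of_cyc_adj (hc : IsCycleDecomp G ℓ c) {k k' : K} {x y x' y' : ZMod ℓ}
    (h : (cyc ℓ).Adj x y) (h' : (cyc ℓ).Adj x' y')
    (e : s(c k x, c k y) = s(c k' x', c k' y')) : k = k' := by
  rcases h.2 with rfl | rfl <;> rcases h'.2 with rfl | rfl
  · exact (hc.edge_inj _ _ _ _ e).1
  · exact (hc.edge_inj _ _ _ _ (e.trans Sym2.eq_swap)).1
  · exact (hc.edge_inj _ _ _ _ (Sym2.eq_swap.trans e)).1
  · exact (hc.edge_inj _ _ _ _ (Sym2.eq_swap.trans (e.trans Sym2.eq_swap))).1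

/-- An edge moving in `G` determines the cycle `k` by `edge_inj`; its fixed coordinate is an anchor
of `H`, which belongs to only one cycle `k'`. The same holds with the factors exchanged. Inside the
product of the two cycles, `e` does the rest. -/
theorem IsCycleDecomp.box_comp (hc : IsCycleDecomp G ℓ c) (hS : IsAnchored S ℓ m c)
    (hc' : IsCycleDecomp H ℓ' c') (hT : IsAnchored T ℓ' m' c')
    (he : IsCycleDecomp (boxAnch (cyc ℓ) (multiples ℓ m) (cyc ℓ') (multiples ℓ' m')) ℓ'' e) :
    IsCycleDecomp (boxAnch G S H T) ℓ''
      (fun (k : K × K' × K'') t => (c k.1 (e k.2.2 t).1, c' k.2.1 (e k.2.2 t).2)) := by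
  refine ⟨?_, ?_, ?_, ?_⟩
  · rintro ⟨k, k', k''⟩ t
    rcases he.adj k'' t with ⟨h₁, h₂, h₃⟩ | ⟨h₁, h₂, h₃⟩
    · exact Or.inl ⟨hc.adj_of_cyc_adj k h₁, congrArg (c' k') h₂, hT.mem _ _ h₃⟩
    · exact Or.inr ⟨hc'.adj_of_cyc_adj k' h₁, congrArg (c k) h₂, hS.mem _ _ h₃⟩
  · rintro ⟨k, k', k''⟩ t t' h
    simp only [Prod.mk.injEq] at h
    exact he.inj k'' (Prod.ext (hc.inj _ h.1) (hc'.inj _ h.2))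
  · rintro ⟨k, k', k''⟩ t ⟨j, j', j''⟩ t' h
    suffices hk : k = j ∧ k' = j' by
      obtain ⟨rfl, rfl⟩ := hk
      have hinj : Function.Injective (fun p : ZMod ℓ × ZMod ℓ' => (c k p.1, c' k' p.2)) := by
        rintro p q h
        simp only [Prod.mk.injEq] at h
        exact Prod.ext (hc.inj _ h.1) (hc'.inj _ h.2)
      have := he.edge_inj k'' t j'' t' (Sym2.map.injective hinj (by simpa using h))
      exact ⟨by rw [this.1], this.2⟩
    have hV := congrArg (Sym2.map Prod.fst) h
    have hW := congrArg (Sym2.map Prod.snd) h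
    simp only [Sym2.map_mk] at hV hW
    rcases he.adj k'' t with ⟨h₁, h₂, h₃⟩ | ⟨h₁, h₂, h₃⟩ <;>
      rcases he.adj j'' t' with ⟨h₁', h₂', h₃'⟩ | ⟨h₁', h₂', h₃'⟩
    · refine ⟨hc.eq_of_cyc_adj h₁ h₁' hV, (hT.unique _ _ _ _ h₃ h₃' ?_).1⟩
      rw [← h₂, ← h₂'] at hW
      simpa using hW
    -- A horizontal edge cannot equal a vertical one: its first coordinate would both move and stand
    -- still.
    · rw [← h₂'] at hV
      simp only [Sym2.eq_iff] at hV
      exact ((hc.adj_of_cyc_adj k h₁).ne (by grind)).elim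
    · rw [← h₂] at hV
      simp only [Sym2.eq_iff] at hV
      exact ((hc.adj_of_cyc_adj j h₁').ne (by grind)).elim
    · refine ⟨(hS.unique _ _ _ _ h₃ h₃' ?_).1, hc'.eq_of_cyc_adj h₁ h₁' hW⟩
      rw [← h₂, ← h₂'] at hV
      simpa using hV
  · rintro ⟨v, w⟩ ⟨v', w'⟩ (⟨h₁, h₂, h₃⟩ | ⟨h₁, h₂, h₃⟩)
    · simp only at h₁ h₂ h₃
      subst h₂
      obtain ⟨k', y, hy, rfl⟩ := hT.exists_time w h₃
      obtain ⟨k, x, hx⟩ := hc.edge_surj v v' h₁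
      obtain ⟨k'', t, ht⟩ := he.edge_surj (x, y) (x + 1, y) (Or.inl ⟨hc.cyc_adj k x, rfl, hy⟩)
      refine ⟨(k, k', k''), t, ?_⟩
      have := congrArg (Sym2.map fun p : ZMod ℓ × ZMod ℓ' => (c k p.1, c' k' p.2)) ht
      simp only [Sym2.map_mk] at this
      rw [this]
      simpa using congrArg (Sym2.map fun u => (u, c' k' y)) hx
    · simp only at h₁ h₂ h₃
      subst h₂
      obtain ⟨k, x, hx, rfl⟩ := hS.exists_time v h₃
      obtain ⟨k', y, hy⟩ := hc'.edge_surj w w' h₁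
      obtain ⟨k'', t, ht⟩ := he.edge_surj (x, y) (x, y + 1) (Or.inr ⟨hc'.cyc_adj k' y, rfl, hx⟩)
      refine ⟨(k, k', k''), t, ?_⟩
      have := congrArg (Sym2.map fun p : ZMod ℓ × ZMod ℓ' => (c k p.1, c' k' p.2)) ht
      simp only [Sym2.map_mk] at this
      rw [this]
      simpa using congrArg (Sym2.map fun u => (c k x, u)) hy

theorem IsAnchored.box_comp (hS : IsAnchored S ℓ m c) (hT : IsAnchored T ℓ' m' c')
    (he : IsAnchored (multiples ℓ m ×ˢ multiples ℓ' m') ℓ'' m'' e) :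
    IsAnchored (S ×ˢ T) ℓ'' m''
      (fun (k : K × K' × K'') t => (c k.1 (e k.2.2 t).1, c' k.2.1 (e k.2.2 t).2)) := by
  refine ⟨?_, ?_, ?_⟩
  · rintro ⟨k, k', k''⟩ t h
    have := he.mem k'' t h
    exact ⟨hS.mem _ _ this.1, hT.mem _ _ this.2⟩
  · rintro ⟨v, w⟩ ⟨hv, hw⟩
    obtain ⟨k, x, hx, rfl⟩ := hS.exists_time v hv
    obtain ⟨k', y, hy, rfl⟩ := hT.exists_time w hw
    obtain ⟨k'', t, ht, hxy⟩ := he.exists_time (x, y) ⟨hx, hy⟩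
    exact ⟨(k, k', k''), t, ht, by simp [hxy]⟩
  · rintro ⟨k, k', k''⟩ t ⟨j, j', j''⟩ t' ht ht' h
    simp only [Prod.mk.injEq] at h
    have h₁ := he.mem k'' t ht
    have h₂ := he.mem j'' t' ht'
    obtain ⟨rfl, hx⟩ := hS.unique _ _ _ _ h₁.1 h₂.1 h.1
    obtain ⟨rfl, hy⟩ := hT.unique _ _ _ _ h₁.2 h₂.2 h.2
    obtain ⟨rfl, rfl⟩ := he.unique _ _ _ _ ht ht' (Prod.ext hx hy)
    exact ⟨rfl, rfl⟩

end Composition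

theorem AnchoredDecomposable.box {V W : Type} {G : SimpleGraph V} {S : Set V}
    {H : SimpleGraph W} {T : Set W} {ℓ m ℓ' m' ℓ'' m'' : ℕ}
    (hG : AnchoredDecomposable G S ℓ m) (hH : AnchoredDecomposable H T ℓ' m')
    (h : AnchoredDecomposable (boxAnch (cyc ℓ) (multiples ℓ m) (cyc ℓ') (multiples ℓ' m'))
      (multiples ℓ m ×ˢ multiples ℓ' m') ℓ'' m'') :
    AnchoredDecomposable (boxAnch G S H T) (S ×ˢ T) ℓ'' m'' := by
  obtain ⟨K, _, c, hc, hS⟩ := hG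
  obtain ⟨K', _, c', hc', hT⟩ := hH
  obtain ⟨K'', _, e, he, ha⟩ := h
  exact ⟨K × K' × K'', inferInstance, _, hc.box_comp hS hc' hT he, hS.box_comp hT ha⟩

theorem AnchoredDecomposable.box_cycleDecomposable {V W : Type} {G : SimpleGraph V} {S : Set V}
    {H : SimpleGraph W} {T : Set W} {ℓ m ℓ' m' ℓ'' : ℕ}
    (hG : AnchoredDecomposable G S ℓ m) (hH : AnchoredDecomposable H T ℓ' m')
    (h : CycleDecomposable (boxAnch (cyc ℓ) (multiples ℓ m) (cyc ℓ') (multiples ℓ' m')) ℓ'') :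
    CycleDecomposable (boxAnch G S H T) ℓ'' := by
  obtain ⟨K, _, c, hc, hS⟩ := hG
  obtain ⟨K', _, c', hc', hT⟩ := hH
  obtain ⟨K'', _, e, he⟩ := h
  exact ⟨K × K' × K'', inferInstance, _, hc.box_comp hS hc' hT he⟩

theorem anchoredDecomposable_cycleGraph {ℓ y : ℕ} (m : ℕ) (hy : y = ℓ) (hℓ : 3 ≤ ℓ) :
    AnchoredDecomposable (SimpleGraph.cycleGraph y) (everyNth y m) ℓ m := by
  subst hy
  obtain ⟨n, rfl⟩ : ∃ n, y = n + 3 := ⟨y - 3, by omega⟩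
  refine ⟨Unit, inferInstance, fun _ t => t, ⟨?_, ?_, ?_, ?_⟩, ⟨?_, ?_, ?_⟩⟩
  · intro _ t
    exact SimpleGraph.cycleGraph_adj.2 (Or.inr (add_sub_cancel_left t 1))
  · exact fun _ => Function.injective_id
  · rintro _ t _ t' h
    refine ⟨rfl, ?_⟩
    rcases Sym2.eq_iff.1 h with ⟨h, -⟩ | ⟨h₁, h₂⟩
    · exact h
    · exfalso
      have h₂ : t + 1 = t' := h₂
      have h₁ : t = t' + 1 := h₁
      -- Traversing one edge in both directions would make 2 vanish modulo the length.
      have h3 : ((2 : ℕ) : ZMod (n + 3)) = 0 := by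
        have : t + 2 = t := by
          conv_rhs => rw [h₁, ← h₂]
          ring
        simpa using this
      rw [ZMod.natCast_eq_zero_iff] at h3
      have := Nat.le_of_dvd (by norm_num) h3
      omega
  · intro u v h
    rcases SimpleGraph.cycleGraph_adj.1 h with h | h
    · exact ⟨(), v, Sym2.eq_iff.2 (Or.inr ⟨rfl, (sub_eq_iff_eq_add'.1 h).symm⟩)⟩
    · exact ⟨(), u, Sym2.eq_iff.2 (Or.inl ⟨rfl, (sub_eq_iff_eq_add'.1 h).symm⟩)⟩
  · exact fun _ t h => h
  · exact fun v hv => ⟨(), v, hv, rfl⟩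
  · exact fun _ _ _ _ _ _ h => ⟨rfl, h⟩

/-! ### Direction fields on the square lattice. -/

/-- The four directions of travel along the square lattice. -/
inductive Heading
  | east
  | west
  | north
  | south

namespace Heading

/-- The change of the first coordinate. -/
def dx : Heading → ℤ
  | east => 1
  | west => -1
  | north => 0
  | south => 0

/-- The change of the second coordinate. -/
def dy : Heading → ℤ
  | east => 0
  | west => 0
  | north => 1
  | south => -1

/-- `a` for horizontal and `b` for vertical directions. -/
def weight (a b : ℕ) : Heading → ℕ
  | east => a
  | west => a
  | north => b
  | south => b

theorem weight_pos {a b : ℕ} (ha : 0 < a) (hb : 0 < b) (θ : Heading) : 0 < θ.weight a b := by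
  cases θ <;> assumption

/-- Whether the direction is east or west. -/
def Horizontal : Heading → Prop
  | east => True
  | west => True
  | north => False
  | south => False

end Heading

/-- Following the directions `d` from `(x, y)`, one gets to a point after a number of horizontal
and a number of vertical steps. -/
inductive Run (d : ℤ → ℤ → Heading) (x y : ℤ) : ℕ → ℕ → ℤ → ℤ → Prop
  | refl : Run d x y 0 0 x y
  | east {h v x' y'} : Run d x y h v x' y' → d x' y' = .east → Run d x y (h + 1) v (x' + 1) y'
  | west {h v x' y'} : Run d x y h v x' y' → d x' y' = .west → Run d x y (h + 1) v (x' - 1) y'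
  | north {h v x' y'} : Run d x y h v x' y' → d x' y' = .north → Run d x y h (v + 1) x' (y' + 1)
  | south {h v x' y'} : Run d x y h v x' y' → d x' y' = .south → Run d x y h (v + 1) x' (y' - 1)

theorem Run.trans {d : ℤ → ℤ → Heading} {x y x' y' x'' y'' : ℤ} {h v h' v' : ℕ}
    (H : Run d x y h v x' y') (H' : Run d x' y' h' v' x'' y'') :
    Run d x y (h + h') (v + v') x'' y'' := by
  induction H' with
  | refl => exact H
  | east _ e ih => exact ih.east e
  | west _ e ih => exact ih.west e
  | north _ e ih => exact ih.north e
  | south _ e ih => exact ih.south e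

/-- Direction fields of two colours, periodic with periods `p` and `q`, that use every lattice edge
in some colour, and whose trajectories on the torus, represented by the starting points `base`,
close up after `r` horizontal and `r` vertical steps. -/
structure IsTorusPattern {K : Type} (p q r : ℕ) (d : Bool → ℤ → ℤ → Heading)
    (base : K → Bool × ℤ × ℤ) : Prop where
  periodic_fst : ∀ c x y, d c (x + p) y = d c x y
  periodic_snd : ∀ c x y, d c x (y + q) = d c x y
  cover_fst : ∀ x y, ∃ c, d c x y = .east ∨ d c (x + 1) y = .west
  cover_snd : ∀ x y, ∃ c, d c x y = .north ∨ d c x (y + 1) = .south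
  reach : ∀ (c : Bool) (x y : ℤ), ∃ k h v, ∃ x' y' : ℤ, (base k).1 = c ∧
    Run (d c) (base k).2.1 (base k).2.2 h v x' y' ∧
    (x' : ZMod p) = (x : ZMod p) ∧ (y' : ZMod q) = (y : ZMod q)
  ret : ∀ k, ∃ x' y' : ℤ, Run (d (base k).1) (base k).2.1 (base k).2.2 r r x' y' ∧
    (x' : ZMod p) = ((base k).2.1 : ZMod p) ∧ (y' : ZMod q) = ((base k).2.2 : ZMod q)
  card : Nat.card K * r = p * q

/-! ### Grid points among the residues modulo `p * a`. -/

section Blow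

variable {p a : ℕ}

/-- The multiplication by `a`, as a map from the residues modulo `p` to those modulo `p * a`. -/
def blow (p a : ℕ) (x : ZMod p) : ZMod (p * a) := ((a * x.val : ℕ) : ZMod (p * a))

variable [NeZero p]

theorem blow_intCast (z : ℤ) : blow p a (z : ZMod p) = ((a * z : ℤ) : ZMod (p * a)) := by
  have h : (p : ℤ) ∣ ((z : ZMod p).val : ℤ) - z := by
    rw [← ZMod.intCast_zmod_eq_zero_iff_dvd]
    simp
  rw [blow, ← sub_eq_zero, ← Int.cast_natCast, ← Int.cast_sub, ZMod.intCast_zmod_eq_zero_iff_dvd]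
  push_cast
  rw [← mul_sub, mul_comm (p : ℤ)]
  exact mul_dvd_mul_left _ h

theorem blow_add_intCast (x : ZMod p) (z : ℤ) : blow p a (x + z) = blow p a x + a * z := by
  obtain ⟨n, rfl⟩ := ZMod.intCast_surjective x
  rw [← Int.cast_add, blow_intCast, blow_intCast]
  push_cast
  ring

theorem blow_injective [NeZero a] : Function.Injective (blow p a) := by
  intro x x' h
  obtain ⟨z, rfl⟩ := ZMod.intCast_surjective x
  obtain ⟨z', rfl⟩ := ZMod.intCast_surjective x'
  rw [blow_intCast, blow_intCast, ← sub_eq_zero, ← Int.cast_sub,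
    ZMod.intCast_zmod_eq_zero_iff_dvd, ← mul_sub] at h
  push_cast at h
  rw [mul_comm (p : ℤ)] at h
  rw [← sub_eq_zero, ← Int.cast_sub, ZMod.intCast_zmod_eq_zero_iff_dvd]
  exact Int.dvd_of_mul_dvd_mul_left (by exact_mod_cast NeZero.ne a) h

/-- The residue modulo `a` of a residue modulo `p * a`. -/
def resid (p a : ℕ) : ZMod (p * a) →+* ZMod a := ZMod.castHom (dvd_mul_left a p) (ZMod a)

theorem resid_blow (x : ZMod p) : resid p a (blow p a x) = 0 := by
  simp [blow]

theorem mem_multiples_iff [NeZero a] {X : ZMod (p * a)} :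
    X ∈ multiples (p * a) a ↔ ∃ x, X = blow p a x := by
  constructor
  · rintro ⟨n, hn⟩
    refine ⟨(n : ℤ), ?_⟩
    rw [blow_intCast]
    have := ZMod.natCast_zmod_val X
    rw [hn] at this
    rw [← this]
    push_cast
    rfl
  · rintro ⟨x, rfl⟩
    have h := resid_blow (a := a) x
    rw [resid, ZMod.castHom_apply, ZMod.cast_eq_val, ZMod.natCast_eq_zero_iff] at h
    exact h

theorem exists_eq_blow_add [NeZero a] (X : ZMod (p * a)) :
    ∃ x, ∃ u < a, X = blow p a x + (u : ℕ) := by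
  refine ⟨((X.val / a : ℕ) : ℤ), X.val % a, Nat.mod_lt _ (NeZero.pos a), ?_⟩
  rw [blow_intCast]
  conv_lhs => rw [← ZMod.natCast_zmod_val X, ← Nat.div_add_mod X.val a]
  simp only [Nat.cast_add, Nat.cast_mul, Int.cast_mul, Int.cast_natCast]

end Blow

/-! ### Walking along the subdivided edges of the torus. -/

namespace IsTorusPattern

section Walk

variable {p q : ℕ} (a b : ℕ) (d : Bool → ℤ → ℤ → Heading)

/-- The direction at a point of the torus. -/
def heading (e : Bool × ZMod p × ZMod q) : Heading := d e.1 (e.2.1.val : ℤ) (e.2.2.val : ℤ)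

/-- The next point of the torus. -/
def next (e : Bool × ZMod p × ZMod q) : Bool × ZMod p × ZMod q :=
  (e.1, e.2.1 + ((heading d e).dx : ℤ), e.2.2 + ((heading d e).dy : ℤ))

/-- The positions along the subdivided edges of the torus. -/
abbrev Position (p q : ℕ) : Type :=
  {s : (Bool × ZMod p × ZMod q) × ℕ // s.2 < (heading d s.1).weight a b}

variable {a b} in
/-- The beginning of the edge that leaves a point of the torus. -/
def start (ha : 0 < a) (hb : 0 < b) (e : Bool × ZMod p × ZMod q) : Position a b d p q :=
  ⟨(e, 0), Heading.weight_pos ha hb _⟩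

variable {a b} in
/-- One step along the subdivided edges of the torus. -/
def step (ha : 0 < a) (hb : 0 < b) (s : Position a b d p q) : Position a b d p q :=
  if h : s.1.2 + 1 < (heading d s.1.1).weight a b then ⟨(s.1.1, s.1.2 + 1), h⟩
  else start d ha hb (next d s.1.1)

variable {a b d} in
/-- The vertex at a position. -/
def vertex (s : Position a b d p q) : ZMod (p * a) × ZMod (q * b) :=
  (blow p a s.1.1.2.1 + ((s.1.2 * (heading d s.1.1).dx : ℤ) : ZMod (p * a)),
    blow q b s.1.1.2.2 + ((s.1.2 * (heading d s.1.1).dy : ℤ) : ZMod (q * b)))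

variable {a b d} in
/-- The edge between a position and the next, given by its lower end. -/
def label (s : Position a b d p q) : (ZMod (p * a) × ZMod q) ⊕ (ZMod p × ZMod (q * b)) :=
  match heading d s.1.1 with
  | .east => .inl (blow p a s.1.1.2.1 + (s.1.2 : ℕ), s.1.1.2.2)
  | .west => .inl (blow p a s.1.1.2.1 - (s.1.2 : ℕ) - 1, s.1.1.2.2)
  | .north => .inr (s.1.1.2.1, blow q b s.1.1.2.2 + (s.1.2 : ℕ))
  | .south => .inr (s.1.1.2.1, blow q b s.1.1.2.2 - (s.1.2 : ℕ) - 1)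

/-- The edge with a given lower end. -/
def labelEdge (p q a b : ℕ) : (ZMod (p * a) × ZMod q) ⊕ (ZMod p × ZMod (q * b)) →
    Sym2 (ZMod (p * a) × ZMod (q * b))
  | .inl (X, y) => s((X, blow q b y), (X + 1, blow q b y))
  | .inr (x, Y) => s((blow p a x, Y), (blow p a x, Y + 1))

theorem one_ne_neg_one {n : ℕ} (hn : 3 ≤ n) {x : ZMod n} (h : x + 1 + 1 = x) : False := by
  have h3 : ((2 : ℕ) : ZMod n) = 0 := by
    have : x + 2 = x := by
      conv_rhs => rw [← h]
      ring
    simpa using this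
  rw [ZMod.natCast_eq_zero_iff] at h3
  have := Nat.le_of_dvd (by norm_num) h3
  omega

theorem one_ne_zero' {n : ℕ} (hn : 3 ≤ n) {x : ZMod n} (h : x + 1 = x) : False :=
  one_ne_neg_one hn (by rw [h, h])

variable {a b} in
-- The changing coordinate separates horizontal from vertical edges. Lengths of at least 3 exclude
-- that two edges, given by different lower ends, have the same two ends in opposite order.
theorem labelEdge_injective [NeZero p] [NeZero q] [NeZero a] [NeZero b]
    (hpa : 3 ≤ p * a) (hqb : 3 ≤ q * b) : Function.Injective (labelEdge p q a b) := by
  have h₁ := @blow_injective p a _ _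
  have h₂ := @blow_injective q b _ _
  rintro (⟨X, y⟩ | ⟨x, Y⟩) (⟨X', y'⟩ | ⟨x', Y'⟩) h <;>
    simp only [labelEdge, Sym2.eq_iff, Prod.mk.injEq] at h
  · rcases h with ⟨⟨rfl, h⟩, -⟩ | ⟨⟨rfl, h⟩, h', -⟩
    · rw [h₂ h]
    · exact (one_ne_neg_one hpa h').elim
  · exfalso
    rcases h with ⟨⟨rfl, h⟩, h', -⟩ | ⟨⟨rfl, h⟩, h', -⟩ <;> exact one_ne_zero' hpa h'
  · exfalso
    rcases h with ⟨⟨h, rfl⟩, -, h'⟩ | ⟨⟨h, h''⟩, -, h'⟩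
    · exact one_ne_zero' hqb (h'.trans rfl)
    · exact one_ne_zero' hqb (h'.trans h''.symm)
  · rcases h with ⟨⟨h, rfl⟩, -⟩ | ⟨⟨h, rfl⟩, -, h'⟩
    · rw [h₁ h]
    · exact (one_ne_neg_one hqb h').elim

variable {a b d} (ha : 0 < a) (hb : 0 < b)

theorem step_of_lt (s : Position a b d p q)
    (h : s.1.2 + 1 < (heading d s.1.1).weight a b) :
    step d ha hb s = ⟨(s.1.1, s.1.2 + 1), h⟩ :=
  dif_pos h

theorem step_of_le (s : Position a b d p q)
    (h : (heading d s.1.1).weight a b ≤ s.1.2 + 1) :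
    step d ha hb s = start d ha hb (next d s.1.1) :=
  dif_neg h.not_gt

theorem iterate_step_start (e : Bool × ZMod p × ZMod q) (u : ℕ)
    (hu : u < (heading d e).weight a b) :
    (step d ha hb)^[u] (start d ha hb e) = ⟨(e, u), hu⟩ := by
  induction u with
  | zero => rfl
  | succ u ih =>
    rw [Function.iterate_succ_apply', ih (by omega), step_of_lt ha hb _ hu]

theorem iterate_step_weight (e : Bool × ZMod p × ZMod q) :
    (step d ha hb)^[(heading d e).weight a b] (start d ha hb e) = start d ha hb (next d e) := by
  have h := Heading.weight_pos ha hb (heading d e)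
  obtain ⟨u, hu⟩ := Nat.exists_eq_succ_of_ne_zero h.ne'
  rw [hu, Function.iterate_succ_apply', iterate_step_start ha hb e u (by omega), step_of_le]
  exact hu.le

theorem fst_iterate_step (s : Position a b d p q) (n : ℕ) :
    ((step d ha hb)^[n] s).1.1.1 = s.1.1.1 := by
  induction n with
  | zero => rfl
  | succ n ih =>
    rw [Function.iterate_succ_apply', ← ih]
    generalize (step d ha hb)^[n] s = s'
    rcases lt_or_ge (s'.1.2 + 1) ((heading d s'.1.1).weight a b) with h | h
    · rw [step_of_lt ha hb s' h]
    · rw [step_of_le ha hb s' h]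
      rfl

variable [NeZero p] [NeZero q]

theorem vertex_step (s : Position a b d p q) :
    vertex (step d ha hb s) = vertex s + ((((heading d s.1.1).dx : ℤ) : ZMod (p * a)),
      (((heading d s.1.1).dy : ℤ) : ZMod (q * b))) := by
  rcases lt_or_ge (s.1.2 + 1) ((heading d s.1.1).weight a b) with h | h
  · rw [step_of_lt ha hb s h]
    simp only [vertex, Prod.mk_add_mk]
    push_cast
    ext <;> simp only <;> ring
  · have h' : s.1.2 + 1 = (heading d s.1.1).weight a b := by
      have := s.2
      omega
    rw [step_of_le ha hb s h]
    simp only [vertex, start, next, blow_add_intCast, Prod.mk_add_mk]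
    rcases hs : heading d s.1.1 <;> rw [hs] at h' <;> simp only [Heading.weight] at h' <;>
      simp only [Heading.dx, Heading.dy, ← h'] <;> push_cast <;> ext <;> simp only <;> ring

theorem edge_eq_labelEdge (s : Position a b d p q) :
    s(vertex s, vertex (step d ha hb s)) = labelEdge p q a b (label s) := by
  rw [vertex_step]
  unfold label
  rcases hs : heading d s.1.1 <;>
    simp only [labelEdge, vertex, hs, Heading.dx, Heading.dy, Prod.mk_add_mk, Sym2.eq_iff,
      Prod.mk.injEq] <;> push_cast
  · left; refine ⟨⟨?_, ?_⟩, ?_, ?_⟩ <;> ring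
  · right; refine ⟨⟨?_, ?_⟩, ?_, ?_⟩ <;> ring
  · left; refine ⟨⟨?_, ?_⟩, ?_, ?_⟩ <;> ring
  · right; refine ⟨⟨?_, ?_⟩, ?_, ?_⟩ <;> ring

theorem adj_step (hpa : 3 ≤ p * a) (hqb : 3 ≤ q * b) (s : Position a b d p q) :
    (boxAnch (cyc (p * a)) (multiples (p * a) a) (cyc (q * b)) (multiples (q * b) b)).Adj
      (vertex s) (vertex (step d ha hb s)) := by
  have : NeZero a := ⟨ha.ne'⟩
  have : NeZero b := ⟨hb.ne'⟩
  have key : ∀ {n : ℕ} (_ : 3 ≤ n) (x : ZMod n), (cyc n).Adj x (x + 1) :=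
    fun hn x => ⟨fun h => one_ne_zero' hn h.symm, Or.inl rfl⟩
  rw [← SimpleGraph.mem_edgeSet, edge_eq_labelEdge]
  rcases label s with ⟨X, y⟩ | ⟨x, Y⟩
  · exact Or.inl ⟨key hpa X, rfl, mem_multiples_iff.2 ⟨y, rfl⟩⟩
  · exact Or.inr ⟨key hqb Y, rfl, mem_multiples_iff.2 ⟨x, rfl⟩⟩

theorem exists_labelEdge [NeZero a] [NeZero b] {u v : ZMod (p * a) × ZMod (q * b)}
    (h : (boxAnch (cyc (p * a)) (multiples (p * a) a) (cyc (q * b)) (multiples (q * b) b)).Adj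
      u v) : ∃ l, labelEdge p q a b l = s(u, v) := by
  obtain ⟨X, Y⟩ := u
  obtain ⟨X', Y'⟩ := v
  rcases h with ⟨⟨-, h₁⟩, h₂, h₃⟩ | ⟨⟨-, h₁⟩, h₂, h₃⟩ <;> simp only at h₁ h₂ h₃ <;> subst h₂ <;>
    obtain ⟨y, rfl⟩ := mem_multiples_iff.1 h₃ <;> rcases h₁ with rfl | rfl
  · exact ⟨.inl (X, y), rfl⟩
  · exact ⟨.inl (X', y), Sym2.eq_swap⟩
  · exact ⟨.inr (y, Y), rfl⟩
  · exact ⟨.inr (y, Y'), Sym2.eq_swap⟩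

end Walk

end IsTorusPattern

/-! ### From torus patterns to cycle decompositions. -/

namespace IsTorusPattern

variable {K : Type} {p q r a b : ℕ} [NeZero p] [NeZero q]
  {d : Bool → ℤ → ℤ → Heading} {base : K → Bool × ℤ × ℤ} (ha : 0 < a) (hb : 0 < b)

theorem heading_intCast (h : IsTorusPattern p q r d base) (c : Bool) (x y : ℤ) :
    heading d (c, (x : ZMod p), (y : ZMod q)) = d c x y := by
  have hx : Function.Periodic (fun x => d c x (y % q)) (p : ℤ) := fun x => h.periodic_fst c x _
  have hy : Function.Periodic (fun y => d c x y) (q : ℤ) := fun y => h.periodic_snd c x y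
  have e₁ := hx.int_mul (-(x / p)) x
  have e₂ := hy.int_mul (-(y / q)) y
  simp only [heading, ZMod.val_intCast]
  rw [Int.cast_id] at e₁ e₂
  rw [← e₂, ← show y % q = y + -(y / q) * q by rw [Int.emod_def]; ring, ← e₁]
  congr 1
  rw [Int.emod_def]
  ring

/-- A run lives in the plane; reducing its coordinates and expanding each step into `a` or `b` small
ones gives the walk on the subdivided torus. -/
theorem iterate_step_run (h : IsTorusPattern p q r d base) {c : Bool} {x y x' y' : ℤ} {m n : ℕ}
    (H : Run (d c) x y m n x' y') :
    (step d ha hb)^[m * a + n * b] (start d ha hb (c, (x : ZMod p), (y : ZMod q))) =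
      start d ha hb (c, (x' : ZMod p), (y' : ZMod q)) := by
  induction H with
  | refl => simp
  | @east m n x' y' _ e ih =>
    rw [show (m + 1) * a + n * b = a + (m * a + n * b) by ring, Function.iterate_add_apply, ih]
    have := iterate_step_weight ha hb (d := d) (c, (x' : ZMod p), (y' : ZMod q))
    rw [next, h.heading_intCast, e] at this
    simpa [Heading.weight, Heading.dx, Heading.dy] using this
  | @west m n x' y' _ e ih =>
    rw [show (m + 1) * a + n * b = a + (m * a + n * b) by ring, Function.iterate_add_apply, ih]
    have := iterate_step_weight ha hb (d := d) (c, (x' : ZMod p), (y' : ZMod q))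
    rw [next, h.heading_intCast, e] at this
    simpa [Heading.weight, Heading.dx, Heading.dy, sub_eq_add_neg] using this
  | @north m n x' y' _ e ih =>
    rw [show m * a + (n + 1) * b = b + (m * a + n * b) by ring, Function.iterate_add_apply, ih]
    have := iterate_step_weight ha hb (d := d) (c, (x' : ZMod p), (y' : ZMod q))
    rw [next, h.heading_intCast, e] at this
    simpa [Heading.weight, Heading.dx, Heading.dy] using this
  | @south m n x' y' _ e ih =>
    rw [show m * a + (n + 1) * b = b + (m * a + n * b) by ring, Function.iterate_add_apply, ih]
    have := iterate_step_weight ha hb (d := d) (c, (x' : ZMod p), (y' : ZMod q))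
    rw [next, h.heading_intCast, e] at this
    simpa [Heading.weight, Heading.dx, Heading.dy, sub_eq_add_neg] using this

variable (p q r d base) in
/-- The position at a given time on the trajectory with a given starting point. -/
def position (k : K) (t : ZMod (r * (a + b))) : Position a b d p q :=
  (step d ha hb)^[t.val] (start d ha hb
    ((base k).1, ((base k).2.1 : ZMod p), ((base k).2.2 : ZMod q)))

theorem r_ne_zero (h : IsTorusPattern p q r d base) : r ≠ 0 := by
  rintro rfl
  have := h.card
  rw [mul_zero, eq_comm, mul_eq_zero] at this
  exact this.elim (NeZero.ne p) (NeZero.ne q)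

theorem iterate_step_eq_position (h : IsTorusPattern p q r d base) (k : K) (n : ℕ) :
    (step d ha hb)^[n] (start d ha hb
      ((base k).1, ((base k).2.1 : ZMod p), ((base k).2.2 : ZMod q))) =
      position p q r d base ha hb k (n : ZMod (r * (a + b))) := by
  have hp : Function.IsPeriodicPt (step d ha hb) (r * (a + b)) (start d ha hb
      ((base k).1, ((base k).2.1 : ZMod p), ((base k).2.2 : ZMod q))) := by
    obtain ⟨x', y', H, hx, hy⟩ := h.ret k
    have := h.iterate_step_run ha hb H
    rw [hx, hy] at this
    rw [mul_add]
    exact this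
  rw [position, ZMod.val_natCast, hp.iterate_mod_apply]

theorem position_add_one (h : IsTorusPattern p q r d base) (k : K) (t : ZMod (r * (a + b))) :
    position p q r d base ha hb k (t + 1) = step d ha hb (position p q r d base ha hb k t) := by
  have : NeZero (r * (a + b)) := ⟨mul_ne_zero h.r_ne_zero (by omega)⟩
  obtain ⟨n, rfl⟩ := ZMod.natCast_zmod_surjective t
  rw [← Nat.cast_add_one, ← h.iterate_step_eq_position, ← h.iterate_step_eq_position,
    Function.iterate_succ_apply']

theorem exists_position (h : IsTorusPattern p q r d base) (s : Position a b d p q) :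
    ∃ k t, position p q r d base ha hb k t = s := by
  obtain ⟨⟨⟨c, x, y⟩, u⟩, hu⟩ := s
  obtain ⟨x, rfl⟩ := ZMod.intCast_surjective x
  obtain ⟨y, rfl⟩ := ZMod.intCast_surjective y
  obtain ⟨k, m, n, x', y', rfl, H, hx, hy⟩ := h.reach c x y
  have := h.iterate_step_run ha hb H
  rw [hx, hy] at this
  refine ⟨k, ((u + (m * a + n * b) : ℕ)), ?_⟩
  rw [← h.iterate_step_eq_position, Function.iterate_add_apply, this,
    iterate_step_start ha hb _ u hu]

theorem exists_label (h : IsTorusPattern p q r d base) [NeZero a] [NeZero b]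
    (l : (ZMod (p * a) × ZMod q) ⊕ (ZMod p × ZMod (q * b))) :
    ∃ s : Position a b d p q, label s = l := by
  rcases l with ⟨X, y⟩ | ⟨x, Y⟩
  · obtain ⟨x, u, hu, rfl⟩ := exists_eq_blow_add X
    obtain ⟨x, rfl⟩ := ZMod.intCast_surjective x
    obtain ⟨y, rfl⟩ := ZMod.intCast_surjective y
    obtain ⟨c, e | e⟩ := h.cover_fst x y <;> rw [← h.heading_intCast] at e
    · refine ⟨⟨((c, _, _), u), by rw [e]; exact hu⟩, ?_⟩
      simp only [label]
      rw [e]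
    -- Going west from the right end `x + 1`, the small edge with lower end at offset `u` is
    -- traversed after `a - 1 - u` small steps.
    · refine ⟨⟨((c, _, _), a - 1 - u), by rw [e]; change _ < a; omega⟩, ?_⟩
      simp only [label]
      rw [e]
      simp only [Sum.inl.injEq, Prod.mk.injEq, and_true]
      rw [Int.cast_add, blow_add_intCast, Nat.sub_sub, Nat.cast_sub (by omega)]
      push_cast
      ring
  · obtain ⟨y, u, hu, rfl⟩ := exists_eq_blow_add Y
    obtain ⟨x, rfl⟩ := ZMod.intCast_surjective x
    obtain ⟨y, rfl⟩ := ZMod.intCast_surjective y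
    obtain ⟨c, e | e⟩ := h.cover_snd x y <;> rw [← h.heading_intCast] at e
    · refine ⟨⟨((c, _, _), u), by rw [e]; exact hu⟩, ?_⟩
      simp only [label]
      rw [e]
    · refine ⟨⟨((c, _, _), b - 1 - u), by rw [e]; change _ < b; omega⟩, ?_⟩
      simp only [label]
      rw [e]
      simp only [Sum.inr.injEq, Prod.mk.injEq, true_and]
      rw [Int.cast_add, blow_add_intCast, Nat.sub_sub, Nat.cast_sub (by omega)]
      push_cast
      ring

/-- By `card`, the curves have p * q * (a + b) small steps in total, as many as there are small
edges. Since every edge is covered, every edge is used exactly once; edge-disjointness never has to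
be checked for a particular pattern. -/
theorem label_position_bijective [Finite K] (h : IsTorusPattern p q r d base) :
    Function.Bijective (fun kt : K × ZMod (r * (a + b)) =>
      label (position p q r d base ha hb kt.1 kt.2)) := by
  have : NeZero a := ⟨ha.ne'⟩
  have : NeZero b := ⟨hb.ne'⟩
  have : NeZero (r * (a + b)) := ⟨mul_ne_zero h.r_ne_zero (by omega)⟩
  refine Function.Surjective.bijective_of_nat_card_le (fun l => ?_) ?_
  · obtain ⟨s, rfl⟩ := h.exists_label l
    obtain ⟨k, t, rfl⟩ := h.exists_position ha hb s
    exact ⟨(k, t), rfl⟩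
  · simp only [Nat.card_prod, Nat.card_sum, Nat.card_zmod]
    rw [← mul_assoc, h.card]
    exact le_of_eq (by ring)

theorem label_injective [Finite K] (ha : 0 < a) (hb : 0 < b) (h : IsTorusPattern p q r d base) :
    Function.Injective (label : Position a b d p q → _) := by
  intro s s' e
  obtain ⟨k, t, rfl⟩ := h.exists_position ha hb s
  obtain ⟨k', t', rfl⟩ := h.exists_position ha hb s'
  have := (h.label_position_bijective ha hb).1 (a₁ := (k, t)) (a₂ := (k', t')) e
  simp only [Prod.mk.injEq] at this
  rw [this.1, this.2]

theorem position_injective [Finite K] (h : IsTorusPattern p q r d base) {k k' : K}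
    {t t' : ZMod (r * (a + b))}
    (e : position p q r d base ha hb k t = position p q r d base ha hb k' t') :
    k = k' ∧ t = t' := by
  simpa using (h.label_position_bijective ha hb).1 (a₁ := (k, t)) (a₂ := (k', t'))
    (congrArg label e)

theorem eq_zero_of_resid {n u : ℕ} (hu : u < n) (h : (u : ZMod n) = 0) : u = 0 :=
  Nat.eq_zero_of_dvd_of_lt ((ZMod.natCast_eq_zero_iff u n).1 h) hu

theorem eq_of_resid {n u u' : ℕ} (hu : u < n) (hu' : u' < n) (h : (u : ZMod n) = u') : u = u' := by
  have := (ZMod.natCast_eq_natCast_iff' u u' n).1 h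
  rwa [Nat.mod_eq_of_lt hu, Nat.mod_eq_of_lt hu'] at this

theorem eq_of_vertex_eq_of_zero [NeZero a] [NeZero b] {s s' : Position a b d p q}
    (hc : s.1.1.1 = s'.1.1.1) (hv : vertex s = vertex s') (hs : s.1.2 = 0) (hs' : s'.1.2 = 0) :
    s = s' := by
  obtain ⟨⟨⟨c, x, y⟩, u⟩, hu⟩ := s
  obtain ⟨⟨⟨c', x', y'⟩, u'⟩, hu'⟩ := s'
  simp only at hc hs hs'
  subst hc hs hs'
  simp only [vertex, Nat.cast_zero, zero_mul, Int.cast_zero, add_zero, Prod.mk.injEq] at hv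
  obtain rfl := blow_injective hv.1
  obtain rfl := blow_injective hv.2
  rfl

/-- If `s` lies strictly inside its edge, the position just before `s` uses the same small edge as
`s'`, in the opposite direction, against `label_injective`. If `s` is at a grid point, an opposite
heading of `s'` puts `s'` there as well, and then colour and vertex determine the position. -/
theorem heading_ne_of_vertex_eq [Finite K] [NeZero a] [NeZero b] (ha : 0 < a) (hb : 0 < b)
    (h : IsTorusPattern p q r d base) {s s' : Position a b d p q} (hc : s.1.1.1 = s'.1.1.1)
    (hv : vertex s = vertex s') :
    ¬ (heading d s.1.1 = .east ∧ heading d s'.1.1 = .west) ∧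
      ¬ (heading d s.1.1 = .north ∧ heading d s'.1.1 = .south) := by
  rcases Nat.eq_zero_or_pos s.1.2 with h0 | h0
  · have key : s'.1.2 = 0 → heading d s.1.1 = heading d s'.1.1 := fun h0' => by
      rw [eq_of_vertex_eq_of_zero hc hv h0 h0']
    have hu := s'.2
    have h₁ := congrArg (fun v => resid p a v.1) hv
    have h₂ := congrArg (fun v => resid q b v.2) hv
    simp only [vertex, map_add, resid_blow, map_intCast, h0] at h₁ h₂
    constructor
    · rintro ⟨e, e'⟩
      rw [e, e'] at key h₁
      rw [e'] at hu
      have := key (eq_zero_of_resid (n := a) hu (by simpa [Heading.dx] using h₁))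
      cases this
    · rintro ⟨e, e'⟩
      rw [e, e'] at key h₂
      rw [e'] at hu
      have := key (eq_zero_of_resid (n := b) hu (by simpa [Heading.dy] using h₂))
      cases this
  · have hs := s.2
    have hcast' : ∀ n : ℕ, ((s.1.2 - 1 : ℕ) : ZMod n) = s.1.2 - 1 := fun n => by
      rw [Nat.cast_sub h0, Nat.cast_one]
    have key : label (⟨(s.1.1, s.1.2 - 1), (Nat.sub_le _ _).trans_lt hs⟩ : Position a b d p q) =
        label s' →
        heading d s.1.1 = heading d s'.1.1 := fun e =>
      congrArg (fun s => heading d s.1.1) (h.label_injective ha hb e)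
    simp only [vertex, Prod.mk.injEq] at hv
    obtain ⟨h₁, h₂⟩ := hv
    constructor
    · rintro ⟨e, e'⟩
      rw [e, e'] at h₁ h₂
      simp only [label] at key
      rw [e, e'] at key
      simp only [Heading.dy, mul_zero, Int.cast_zero, add_zero] at h₂
      simp only [Heading.dx] at h₁
      push_cast at h₁
      have := key (by
        simp only [blow_injective h₂, hcast']
        refine congrArg (fun X => Sum.inl (X, _)) ?_
        linear_combination h₁)
      cases this
    · rintro ⟨e, e'⟩
      rw [e, e'] at h₁ h₂
      simp only [label] at key
      rw [e, e'] at key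
      simp only [Heading.dx, mul_zero, Int.cast_zero, add_zero] at h₁
      simp only [Heading.dy] at h₂
      push_cast at h₂
      have := key (by
        simp only [blow_injective h₁, hcast']
        refine congrArg (fun X => Sum.inr (_, X)) ?_
        linear_combination h₂)
      cases this

/-- Inside a subdivided edge, the vertex determines the position up to orientation, and opposite
orientations are excluded. At a grid point the colour fixes the way out; curves of different colours
do meet there, so equality of colours is essential. -/
theorem vertex_injective [Finite K] (ha : 0 < a) (hb : 0 < b) (h : IsTorusPattern p q r d base)
    {s s' : Position a b d p q} (hc : s.1.1.1 = s'.1.1.1) (hv : vertex s = vertex s') :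
    s = s' := by
  have : NeZero a := ⟨ha.ne'⟩
  have : NeZero b := ⟨hb.ne'⟩
  have hne := h.heading_ne_of_vertex_eq ha hb hc hv
  have hne' := h.heading_ne_of_vertex_eq ha hb hc.symm hv.symm
  have hzero := eq_of_vertex_eq_of_zero hc hv
  have hsame : s.1.2 = s'.1.2 → heading d s.1.1 = heading d s'.1.1 → s = s' := fun hu hθ => by
    have hv' := hv
    simp only [vertex, Prod.mk.injEq, hu, hθ, add_left_inj] at hv'
    exact Subtype.ext (Prod.ext (Prod.ext hc
      (Prod.ext (blow_injective hv'.1) (blow_injective hv'.2))) hu)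
  have hs := s.2
  have hs' := s'.2
  have h₁ := congrArg (fun v => resid p a v.1) hv
  have h₂ := congrArg (fun v => resid q b v.2) hv
  simp only [vertex, map_add, resid_blow, map_intCast, zero_add] at h₁ h₂
  -- Equal headings compare offsets, opposite headings are impossible, and perpendicular headings
  -- force both offsets to be zero.
  rcases e : heading d s.1.1 <;> rcases e' : heading d s'.1.1 <;>
    rw [e, e'] at hne hne' hsame h₁ h₂ <;> rw [e] at hs <;> rw [e'] at hs' <;>
    simp only [Heading.dx, Heading.dy, mul_one, mul_zero, mul_neg, Int.cast_neg,
      Int.cast_natCast, Int.cast_zero, neg_inj, neg_eq_zero, not_true, and_self,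
      false_and, and_false, eq_comm (a := (0 : ZMod _))] at h₁ h₂ hne hne' hs hs'
  all_goals first
    | exact hsame (eq_of_resid hs hs' h₁) rfl
    | exact hsame (eq_of_resid hs hs' h₂) rfl
    | exact hzero (eq_zero_of_resid hs h₁) (eq_zero_of_resid hs' h₂)
    | exact hzero (eq_zero_of_resid hs h₂) (eq_zero_of_resid hs' h₁)

theorem isCycleDecomp [Finite K] (h : IsTorusPattern p q r d base) (hpa : 3 ≤ p * a)
    (hqb : 3 ≤ q * b) :
    IsCycleDecomp
      (boxAnch (cyc (p * a)) (multiples (p * a) a) (cyc (q * b)) (multiples (q * b) b))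
      (r * (a + b)) (fun k t => vertex (position p q r d base ha hb k t)) := by
  have : NeZero a := ⟨ha.ne'⟩
  have : NeZero b := ⟨hb.ne'⟩
  have key : ∀ k t, s(vertex (position p q r d base ha hb k t),
      vertex (position p q r d base ha hb k (t + 1))) =
      labelEdge p q a b (label (position p q r d base ha hb k t)) := fun k t => by
    rw [h.position_add_one, edge_eq_labelEdge]
  refine ⟨fun k t => ?_, fun k t t' e => ?_, fun k t k' t' e => ?_, fun u v e => ?_⟩
  · rw [h.position_add_one]
    exact adj_step ha hb hpa hqb _
  · refine (h.position_injective ha hb (h.vertex_injective ha hb ?_ e)).2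
    rw [position, position, fst_iterate_step, fst_iterate_step]
  · rw [key, key] at e
    exact h.position_injective ha hb (h.label_injective ha hb (labelEdge_injective hpa hqb e))
  · obtain ⟨l, hl⟩ := exists_labelEdge e
    obtain ⟨⟨k, t⟩, rfl⟩ := (h.label_position_bijective ha hb).2 l
    exact ⟨k, t, (key k t).trans hl⟩

end IsTorusPattern

/-! ### Distribution of the anchors when horizontal and vertical steps alternate. -/

namespace IsTorusPattern

section Anchors

variable {K : Type} {p q r a b : ℕ}
  {d : Bool → ℤ → ℤ → Heading} {base : K → Bool × ℤ × ℤ} (ha : 0 < a) (hb : 0 < b)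

/-- The distance from the last beginning of a horizontal edge, when horizontal and vertical edges
alternate. -/
def phase (s : Position a b d p q) : ℕ :=
  match heading d s.1.1 with
  | .east => s.1.2
  | .west => s.1.2
  | .north => a + s.1.2
  | .south => a + s.1.2

theorem phase_lt (s : Position a b d p q) : phase s < a + b := by
  have := s.2
  unfold phase
  rcases e : heading d s.1.1 <;> rw [e] at this <;> simp only [Heading.weight] at this ⊢ <;> omega

theorem phase_eq_zero (ha : 0 < a) {s : Position a b d p q} :
    phase s = 0 ↔ (heading d s.1.1).Horizontal ∧ s.1.2 = 0 := by
  unfold phase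
  rcases e : heading d s.1.1 <;> simp only [Heading.Horizontal] <;> simp <;> omega

variable [NeZero p] [NeZero q]

/-- A horizontal edge followed by a vertical one takes a + b small steps, after which the phase
wraps around to zero. -/
theorem phase_step (h : IsTorusPattern p q r d base)
    (halt : ∀ c x y, (d c x y).Horizontal ↔
      ¬ (d c (x + (d c x y).dx) (y + (d c x y).dy)).Horizontal)
    (s : Position a b d p q) :
    (phase (step d ha hb s) : ZMod (a + b)) = phase s + 1 := by
  have halt' : (heading d s.1.1).Horizontal ↔ ¬ (heading d (next d s.1.1)).Horizontal := by
    obtain ⟨⟨⟨c, x, y⟩, u⟩, hu⟩ := s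
    obtain ⟨x, rfl⟩ := ZMod.intCast_surjective x
    obtain ⟨y, rfl⟩ := ZMod.intCast_surjective y
    simp only [next]
    rw [h.heading_intCast, ← Int.cast_add, ← Int.cast_add, h.heading_intCast]
    exact halt c x y
  have hab : (a : ZMod (a + b)) + b = 0 := by
    rw [← Nat.cast_add, ZMod.natCast_self]
  rcases lt_or_ge (s.1.2 + 1) ((heading d s.1.1).weight a b) with hs | hs
  · rw [step_of_lt ha hb s hs]
    unfold phase
    simp only
    rcases heading d s.1.1 <;> simp only <;> push_cast <;> ring
  · have hs' : s.1.2 + 1 = (heading d s.1.1).weight a b := by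
      have := s.2
      omega
    rw [step_of_le ha hb s hs]
    have hstart : (start d ha hb (next d s.1.1)).1 = (next d s.1.1, 0) := rfl
    unfold phase
    rw [hstart]
    simp only
    clear hs hstart
    generalize heading d (next d s.1.1) = θ' at halt' ⊢
    generalize heading d s.1.1 = θ at halt' hs' ⊢
    have key := congrArg (Nat.cast (R := ZMod (a + b))) hs'
    push_cast at key
    rcases θ <;> rcases θ' <;> simp only [Heading.Horizontal, Heading.weight] at halt' key ⊢ <;>
      first
      | (push_cast; linear_combination -key)
      | (push_cast; linear_combination -key - hab)
      | simp at halt'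

theorem phase_position (h : IsTorusPattern p q r d base)
    (halt : ∀ c x y, (d c x y).Horizontal ↔
      ¬ (d c (x + (d c x y).dx) (y + (d c x y).dy)).Horizontal)
    (hbase : ∀ k, (d (base k).1 (base k).2.1 (base k).2.2).Horizontal)
    (k : K) (t : ZMod (r * (a + b))) :
    (phase (position p q r d base ha hb k t) : ZMod (a + b)) = t.val := by
  unfold position
  generalize t.val = n
  induction n with
  | zero =>
    have : phase (start d ha hb ((base k).1, ((base k).2.1 : ZMod p), ((base k).2.2 : ZMod q)))
        = 0 := by
      rw [phase_eq_zero ha]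
      refine ⟨?_, rfl⟩
      change (heading d (_, _, _)).Horizontal
      rw [h.heading_intCast]
      exact hbase k
    rw [Function.iterate_zero, id, this]
  | succ n ih =>
    rw [Function.iterate_succ_apply', h.phase_step ha hb halt, ih, Nat.cast_succ]

/-- The times divisible by `a + b` are exactly those at which a horizontal edge begins. By `hcol`,
each grid point begins a horizontal edge in exactly one colour, so each anchor is met once at such a
time. -/
theorem isAnchored [Finite K] (h : IsTorusPattern p q r d base)
    (halt : ∀ c x y, (d c x y).Horizontal ↔
      ¬ (d c (x + (d c x y).dx) (y + (d c x y).dy)).Horizontal)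
    (hbase : ∀ k, (d (base k).1 (base k).2.1 (base k).2.2).Horizontal)
    (hcol : ∀ x y, ∃! c, (d c x y).Horizontal) :
    IsAnchored (multiples (p * a) a ×ˢ multiples (q * b) b) (r * (a + b)) (a + b)
      (fun k t => vertex (position p q r d base ha hb k t)) := by
  have : NeZero a := ⟨ha.ne'⟩
  have : NeZero b := ⟨hb.ne'⟩
  have key : ∀ k (t : ZMod (r * (a + b))), a + b ∣ t.val ↔
      (heading d (position p q r d base ha hb k t).1.1).Horizontal ∧
        (position p q r d base ha hb k t).1.2 = 0 := fun k t => by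
    rw [← phase_eq_zero ha, ← ZMod.natCast_eq_zero_iff, ← h.phase_position ha hb halt hbase k t,
      ZMod.natCast_eq_zero_iff]
    exact ⟨fun hd => Nat.eq_zero_of_dvd_of_lt hd (phase_lt _), fun h0 => h0 ▸ dvd_zero _⟩
  have hvert : ∀ s : Position a b d p q, s.1.2 = 0 →
      vertex s = (blow p a s.1.1.2.1, blow q b s.1.1.2.2) := fun s hs => by
    simp [vertex, hs]
  refine ⟨fun k t ht => ?_, ?_, fun k t k' t' ht ht' e => ?_⟩
  · rw [hvert _ ((key k t).1 ht).2]
    exact ⟨mem_multiples_iff.2 ⟨_, rfl⟩, mem_multiples_iff.2 ⟨_, rfl⟩⟩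
  · rintro ⟨X, Y⟩ ⟨hX, hY⟩
    obtain ⟨x, rfl⟩ := mem_multiples_iff.1 hX
    obtain ⟨y, rfl⟩ := mem_multiples_iff.1 hY
    obtain ⟨c, hc, -⟩ := hcol (x.val : ℤ) (y.val : ℤ)
    obtain ⟨k, t, hkt⟩ := h.exists_position ha hb (start d ha hb (c, x, y))
    refine ⟨k, t, ?_, ?_⟩
    · rw [key k t, hkt]
      exact ⟨hc, rfl⟩
    · rw [hkt]
      exact hvert _ rfl
  · have h₁ := (key k t).1 ht
    have h₂ := (key k' t').1 ht'
    simp only [hvert _ h₁.2, hvert _ h₂.2, Prod.mk.injEq] at e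
    have hx := blow_injective e.1
    have hy := blow_injective e.2
    refine h.position_injective ha hb (Subtype.ext (Prod.ext (Prod.ext ?_ (Prod.ext hx hy))
      (h₁.2.trans h₂.2.symm)))
    have h₂' := h₂.1
    rw [heading, ← hx, ← hy] at h₂'
    exact (hcol _ _).unique h₁.1 h₂'

end Anchors

end IsTorusPattern

/-! ### Zigzag patterns: strips and spirals. -/

/-- Trajectories of colour `c` alternate between east, at the points whose coordinate sum has the
parity `c`, and north or south, depending on the column. -/
def zigzag (up : ℤ → Bool) (c : Bool) (x y : ℤ) : Heading :=
  if (x + y) % 2 = (if c then 1 else 0) then .east else if up x then .north else .south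

theorem zigzag_horizontal {up : ℤ → Bool} {c : Bool} {x y : ℤ} :
    (zigzag up c x y).Horizontal ↔ (x + y) % 2 = (if c then 1 else 0) := by
  unfold zigzag
  split_ifs <;> simp_all [Heading.Horizontal]

theorem zigzag_horizontal_iff_not (up : ℤ → Bool) (c : Bool) (x y : ℤ) :
    (zigzag up c x y).Horizontal ↔ ¬ (zigzag up c (x + (zigzag up c x y).dx)
      (y + (zigzag up c x y).dy)).Horizontal := by
  rw [zigzag_horizontal, zigzag_horizontal]
  unfold zigzag
  cases c <;> split_ifs <;> simp only [Heading.dx, Heading.dy] <;> simp_all <;> omega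

theorem existsUnique_zigzag_horizontal (up : ℤ → Bool) (x y : ℤ) :
    ∃! c, (zigzag up c x y).Horizontal := by
  simp only [zigzag_horizontal]
  rcases Int.emod_two_eq (x + y) with h | h
  · exact ⟨false, by simpa using h, fun c hc => by cases c <;> simp_all⟩
  · exact ⟨true, by simpa using h, fun c hc => by cases c <;> simp_all⟩

theorem zigzag_cover_fst (up : ℤ → Bool) (x y : ℤ) :
    ∃ c, zigzag up c x y = .east ∨ zigzag up c (x + 1) y = .west := by
  obtain ⟨c, hc, -⟩ := existsUnique_zigzag_horizontal up x y
  exact ⟨c, Or.inl (if_pos (zigzag_horizontal.1 hc))⟩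

/-- In every column the two colours use the two alternating classes of vertical edges. -/
theorem zigzag_cover_snd (up : ℤ → Bool) (x y : ℤ) :
    ∃ c, zigzag up c x y = .north ∨ zigzag up c x (y + 1) = .south := by
  unfold zigzag
  rcases Int.emod_two_eq (x + y) with h | h <;> rcases e : up x with _ | _
  · exact ⟨false, by right; rw [if_neg (by simp; omega)]; rfl⟩
  · exact ⟨true, by left; rw [if_neg (by simp; omega)]; rfl⟩
  · exact ⟨true, by right; rw [if_neg (by simp; omega)]; rfl⟩
  · exact ⟨false, by left; rw [if_neg (by simp; omega)]; rfl⟩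

theorem zigzag_run {up : ℤ → Bool} {c : Bool} {x y : ℤ}
    (h : (x + y) % 2 = (if c then 1 else 0)) :
    Run (zigzag up c) x y 1 1 (x + 1) (y + if up (x + 1) then 1 else -1) := by
  have h₁ : Run (zigzag up c) x y 1 0 (x + 1) y := Run.refl.east (if_pos h)
  have h₂ : ¬ (x + 1 + y) % 2 = (if c then 1 else 0) := by
    cases c <;> simp at h ⊢ <;> omega
  split_ifs with hu
  · exact h₁.north (by rw [zigzag, if_neg h₂, if_pos hu])
  · exact h₁.south (by rw [zigzag, if_neg h₂, if_neg hu])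

/-- The columns entered are alternately up and down, so the curve oscillates between the rows `y`
and `y + 1`. -/
theorem zigzag_run_row {up : ℤ → Bool} {p : ℕ} {x y : ℤ} (hx : x % 2 = 0)
    (hodd : ∀ n : ℕ, n < p → n % 2 = 1 → up (x + n) = true)
    (heven : ∀ n : ℕ, 0 < n → n < p → n % 2 = 0 → up (x + n) = false)
    {c : Bool} (hy : y % 2 = (if c then 1 else 0)) {n : ℕ} (hn : n < p) :
    Run (zigzag up c) x y n n (x + n) (y + (n : ℤ) % 2) := by
  induction n with
  | zero => simpa using Run.refl
  | succ n ih =>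
    refine (congrArg₂ (Run _ x y _ _) ?_ ?_).mp ((ih (by omega)).trans (zigzag_run ?_))
    · push_cast
      ring
    · rw [show x + (n : ℤ) + 1 = x + ((n + 1 : ℕ) : ℤ) by push_cast; ring]
      rcases Nat.mod_two_eq_zero_or_one n with h | h
      · rw [hodd (n + 1) hn (by omega), if_pos rfl]
        omega
      · rw [heven (n + 1) (by omega) hn (by omega), if_neg (by simp)]
        omega
    · cases c <;> simp at hy ⊢ <;> omega

theorem zigzag_periodic_snd (up : ℤ → Bool) {q : ℕ} (hq : Even q) (c : Bool) (x y : ℤ) :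
    zigzag up c x (y + q) = zigzag up c x y := by
  obtain ⟨m, rfl⟩ := hq
  have : (x + (y + ((m + m : ℕ) : ℤ))) % 2 = (x + y) % 2 := by omega
  unfold zigzag
  rw [this]

theorem zigzag_periodic_fst {up : ℤ → Bool} {p : ℕ} (hp : Even p) (hup : ∀ x, up (x + p) = up x)
    (c : Bool) (x y : ℤ) :
    zigzag up c (x + p) y = zigzag up c x y := by
  obtain ⟨m, rfl⟩ := hp
  have : (x + ((m + m : ℕ) : ℤ) + y) % 2 = (x + y) % 2 := by omega
  unfold zigzag
  rw [this, hup]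

/-- Only points where the colour goes east have to be reached: any other point is entered by an east
step from its left neighbour. -/
theorem zigzag_reach {K : Type} {up : ℤ → Bool} {p q : ℕ} (hp : Even p) (hq : Even q)
    {base : K → Bool × ℤ × ℤ}
    (h : ∀ (c : Bool) (x y : ℤ), (x + y) % 2 = (if c then 1 else 0) →
      ∃ k h v x' y', (base k).1 = c ∧ Run (zigzag up c) (base k).2.1 (base k).2.2 h v x' y' ∧
        (x' : ZMod p) = (x : ZMod p) ∧ (y' : ZMod q) = (y : ZMod q)) (c : Bool) (x y : ℤ) :
    ∃ k h v x' y', (base k).1 = c ∧ Run (zigzag up c) (base k).2.1 (base k).2.2 h v x' y' ∧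
      (x' : ZMod p) = (x : ZMod p) ∧ (y' : ZMod q) = (y : ZMod q) := by
  by_cases hxy : (x + y) % 2 = (if c then 1 else 0)
  · exact h c x y hxy
  have hxy' : (x - 1 + y) % 2 = (if c then 1 else 0) := by
    cases c <;> simp at hxy ⊢ <;> omega
  obtain ⟨k, m, n, x', y', hk, H, hx', hy'⟩ := h c (x - 1) y hxy'
  refine ⟨k, m + 1, n, x' + 1, y', hk, H.east (if_pos ?_), ?_, hy'⟩
  -- The parity of the coordinate sum survives reduction modulo the even numbers `p` and `q`.
  · rw [← hxy']
    obtain ⟨u, hu⟩ := (ZMod.intCast_eq_intCast_iff_dvd_sub _ _ _).1 hx'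
    obtain ⟨v, hv⟩ := (ZMod.intCast_eq_intCast_iff_dvd_sub _ _ _).1 hy'
    obtain ⟨s, rfl⟩ := hp
    obtain ⟨t, rfl⟩ := hq
    have hu' : x - 1 - x' = 2 * (s * u) := by rw [hu]; push_cast; ring
    have hv' : y - y' = 2 * (t * v) := by rw [hv]; push_cast; ring
    omega
  · push_cast at hx' ⊢
    rw [hx', sub_add_cancel]

/-- With columns alternately up and down, vertical steps cancel over one turn. There is one closed
curve for each lower row `k`, with the parity of `k` as its colour. -/
theorem isTorusPattern_zigzag_strips {p q : ℕ} (hp : Even p) (hq : Even q) (hp0 : 0 < p)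
    (hq0 : 0 < q) :
    IsTorusPattern p q p (zigzag fun x => decide (x % 2 = 1))
      (fun k : Fin q => (decide ((k : ℕ) % 2 = 1), 0, (k : ℤ))) := by
  -- The bound `p + 1` includes the step at `n = p` that closes the curve.
  have hodd : ∀ n : ℕ, n < p + 1 → n % 2 = 1 →
      (fun x : ℤ => decide (x % 2 = 1)) (0 + n) = true := fun n _ h => by simp; omega
  have heven : ∀ n : ℕ, 0 < n → n < p + 1 → n % 2 = 0 →
      (fun x : ℤ => decide (x % 2 = 1)) (0 + n) = false := fun n _ _ h => by simp; omega
  obtain ⟨P, rfl⟩ := hp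
  obtain ⟨Q, rfl⟩ := hq
  have hpar : ∀ k : ℕ, (k : ℤ) % 2 = (if decide (k % 2 = 1) = true then 1 else 0) := fun k => by
    split_ifs with h <;> simp at h <;> omega
  refine ⟨zigzag_periodic_fst ⟨P, rfl⟩ fun x => ?_, zigzag_periodic_snd _ ⟨Q, rfl⟩,
    zigzag_cover_fst _, zigzag_cover_snd _, zigzag_reach ⟨P, rfl⟩ ⟨Q, rfl⟩ fun c x y hxy => ?_,
    fun k => ?_, by simp [mul_comm]⟩
  · congr 1
    push_cast
    rw [eq_iff_iff]
    omega
  · have hn := Int.emod_nonneg x (b := ((P + P : ℕ) : ℤ)) (by omega)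
    have hn' := Int.emod_lt_of_pos x (b := ((P + P : ℕ) : ℤ)) (by omega)
    -- At column `x` the curve has risen by `x % 2`, so its lower row is `y - x % 2`.
    have hm := Int.emod_nonneg (y - x % 2) (b := ((Q + Q : ℕ) : ℤ)) (by omega)
    have hm' := Int.emod_lt_of_pos (y - x % 2) (b := ((Q + Q : ℕ) : ℤ)) (by omega)
    have hdx := Int.mul_ediv_add_emod x ((P + P : ℕ) : ℤ)
    have hdy := Int.mul_ediv_add_emod (y - x % 2) ((Q + Q : ℕ) : ℤ)
    generalize hn0 : x % ((P + P : ℕ) : ℤ) = n at hn hn' hdx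
    generalize hm0 : (y - x % 2) % ((Q + Q : ℕ) : ℤ) = m at hm hm' hdy
    lift n to ℕ using hn
    lift m to ℕ using hm
    have hx2 : (n : ℤ) % 2 = x % 2 := by
      have : ((P + P : ℕ) : ℤ) * (x / ((P + P : ℕ) : ℤ)) = 2 * (P * (x / ((P + P : ℕ) : ℤ))) := by
        push_cast
        ring
      omega
    have hm2 : (m : ℤ) % 2 = (y - x % 2) % 2 := by
      have : ((Q + Q : ℕ) : ℤ) * ((y - x % 2) / ((Q + Q : ℕ) : ℤ)) =
          2 * (Q * ((y - x % 2) / ((Q + Q : ℕ) : ℤ))) := by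
        push_cast
        ring
      omega
    have hmc : (m : ℤ) % 2 = (if c then 1 else 0) := by rw [← hxy]; omega
    refine ⟨⟨m, by omega⟩, n, n, _, _, ?_,
      zigzag_run_row (p := P + P + 1) (by norm_num) hodd heven hmc (by omega), ?_, ?_⟩
    · cases c <;> simp at hmc ⊢ <;> omega
    · rw [ZMod.intCast_eq_intCast_iff_dvd_sub]
      exact ⟨x / ((P + P : ℕ) : ℤ), by linear_combination (-1 : ℤ) * hdx⟩
    · rw [ZMod.intCast_eq_intCast_iff_dvd_sub]
      exact ⟨(y - x % 2) / ((Q + Q : ℕ) : ℤ), by rw [hx2]; linear_combination (-1 : ℤ) * hdy⟩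
  · refine ⟨_, _, zigzag_run_row (p := P + P + 1) (by norm_num) hodd heven (hpar k) (by omega),
      ?_, ?_⟩
    · rw [zero_add, Int.cast_natCast, ZMod.natCast_self, Int.cast_zero]
    · rw [show ((P + P : ℕ) : ℤ) % 2 = 0 by omega, add_zero]

/-- The columns divisible by `p` go up although they are even. Thus each turn around the torus lifts
the curve by 2, and it closes only after `Q` turns: there is a single curve of each colour. -/
theorem isTorusPattern_zigzag_spirals {p Q : ℕ} (hp : Even p) (hp0 : 0 < p) (hQ : 0 < Q) :
    IsTorusPattern p (2 * Q) (p * Q)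
      (zigzag fun x => decide (x % 2 = 1 ∨ x % (p : ℤ) = 0))
      (fun c : Bool => (c, 0, if c then 1 else 0)) := by
  have hp2 : (2 : ℤ) ∣ p := by exact_mod_cast hp.two_dvd
  have hodd : ∀ j n : ℕ, n < p → n % 2 = 1 →
      (fun x : ℤ => decide (x % 2 = 1 ∨ x % (p : ℤ) = 0)) ((p * j : ℕ) + n) = true :=
    fun j n _ h => by
      obtain ⟨s, hs⟩ := hp2
      have : ((p * j : ℕ) : ℤ) = 2 * (s * j) := by push_cast; rw [hs]; ring
      simp only [decide_eq_true_eq]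
      left
      omega
  have heven : ∀ j n : ℕ, 0 < n → n < p → n % 2 = 0 →
      (fun x : ℤ => decide (x % 2 = 1 ∨ x % (p : ℤ) = 0)) ((p * j : ℕ) + n) = false :=
    fun j n h0 hn h => by
      obtain ⟨s, hs⟩ := hp2
      have : ((p * j : ℕ) : ℤ) = 2 * (s * j) := by push_cast; rw [hs]; ring
      simp only [decide_eq_false_iff_not, not_or]
      refine ⟨by omega, ?_⟩
      push_cast
      rw [Int.mul_add_emod_self_left, Int.emod_eq_of_lt (by omega) (by omega)]
      omega
  have hbase : ∀ c : Bool, (if c then (1 : ℤ) else 0) % 2 = (if c then 1 else 0) := by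
    intro c
    cases c <;> rfl
  have hrow : ∀ (c : Bool) (j n : ℕ), n < p → Run (zigzag (fun x =>
      decide (x % 2 = 1 ∨ x % (p : ℤ) = 0)) c) (p * j : ℕ) ((if c then 1 else 0) + 2 * j) n n
      ((p * j : ℕ) + n) ((if c then 1 else 0) + 2 * j + (n : ℤ) % 2) := fun c j n hn =>
    zigzag_run_row (p := p) (by push_cast; exact Int.emod_eq_zero_of_dvd (hp2.mul_right _))
      (hodd j) (heven j) (by rw [Int.add_mul_emod_self_left, hbase]) hn
  have hwrap : ∀ (c : Bool) (j : ℕ), Run (zigzag (fun x =>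
      decide (x % 2 = 1 ∨ x % (p : ℤ) = 0)) c) 0 (if c then 1 else 0) (p * j) (p * j)
      (p * j : ℕ) ((if c then 1 else 0) + 2 * j) := fun c j => by
    induction j with
    | zero => simpa using Run.refl
    | succ j ih =>
      obtain ⟨s, hs⟩ := hp.two_dvd
      have hup : decide (((p * (j + 1) : ℕ) : ℤ) % 2 = 1 ∨
          ((p * (j + 1) : ℕ) : ℤ) % (p : ℤ) = 0) = true := by simp
      -- The first `p - 1` columns of a turn leave the curve one row higher, since `p - 1` is odd;
      -- the exceptional column adds another row.
      have h₁ := ih.trans ((hrow c j (p - 1) (by omega)).trans (zigzag_run ?_))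
      · rw [show ((p * j : ℕ) : ℤ) + (p - 1 : ℕ) + 1 = (p * (j + 1) : ℕ) by
          rw [Nat.cast_sub (by omega)]; push_cast; ring,
          hup, if_pos (rfl : true = true), show ((p - 1 : ℕ) : ℤ) % 2 = 1 by omega,
          Nat.sub_add_cancel (by omega)] at h₁
        convert h₁ using 1 <;> push_cast <;> ring
      · have : ((p * j : ℕ) : ℤ) = 2 * (s * j) := by rw [hs]; push_cast; ring
        cases c <;> simp <;> omega
  refine ⟨zigzag_periodic_fst hp fun x => ?_, zigzag_periodic_snd _ (even_two_mul Q),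
    zigzag_cover_fst _, zigzag_cover_snd _, zigzag_reach hp (even_two_mul Q) fun c x y hxy => ?_,
    fun c => ?_, by simp; ring⟩
  · rw [Int.add_emod_right]
    congr 1
    rw [eq_iff_iff]
    omega
  · have hn := Int.emod_nonneg x (b := (p : ℤ)) (by omega)
    have hn' := Int.emod_lt_of_pos x (b := (p : ℤ)) (by omega)
    have hdx := Int.mul_ediv_add_emod x (p : ℤ)
    generalize hn0 : x % (p : ℤ) = n at hn hn' hdx
    lift n to ℕ using hn
    have hx2 : (n : ℤ) % 2 = x % 2 := by
      obtain ⟨s, hs⟩ := hp2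
      have : (p : ℤ) * (x / p) = 2 * (s * (x / p)) := by
        linear_combination (x / (p : ℤ)) * hs
      omega
    -- Here `z`, reduced modulo `Q`, is the number of complete turns before the point.
    obtain ⟨z, hz⟩ : ∃ z, y - x % 2 - (if c then 1 else 0) = 2 * z :=
      ⟨(y - x % 2 - (if c then 1 else 0)) / 2, by cases c <;> simp at hxy ⊢ <;> omega⟩
    have hj := Int.emod_nonneg z (b := (Q : ℤ)) (by omega)
    have hdz := Int.mul_ediv_add_emod z (Q : ℤ)
    generalize hj0 : z % (Q : ℤ) = j at hj hdz
    lift j to ℕ using hj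
    refine ⟨c, _, _, _, _, rfl, (hwrap c j).trans (hrow c j n (by omega)), ?_, ?_⟩
    · rw [ZMod.intCast_eq_intCast_iff_dvd_sub]
      exact ⟨x / p - j, by push_cast; linear_combination (-1 : ℤ) * hdx⟩
    · rw [ZMod.intCast_eq_intCast_iff_dvd_sub]
      refine ⟨z / Q, ?_⟩
      push_cast
      rw [hx2]
      linear_combination hz - 2 * hdz
  · refine ⟨_, _, hwrap c Q, ?_, ?_⟩
    · push_cast
      simp
    · have := ZMod.natCast_self (2 * Q)
      push_cast at this ⊢
      rw [this, add_zero]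

theorem anchoredDecomposable_zigzag {K : Type} [Finite K] {p q r a b : ℕ} {up : ℤ → Bool}
    {base : K → Bool × ℤ × ℤ} (h : IsTorusPattern p q r (zigzag up) base) (ha : 0 < a)
    (hb : 0 < b) (hpa : 3 ≤ p * a) (hqb : 3 ≤ q * b)
    (hbase : ∀ k, (zigzag up (base k).1 (base k).2.1 (base k).2.2).Horizontal) :
    AnchoredDecomposable
      (boxAnch (cyc (p * a)) (multiples (p * a) a) (cyc (q * b)) (multiples (q * b) b))
      (multiples (p * a) a ×ˢ multiples (q * b) b) (r * (a + b)) (a + b) := by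
  have : NeZero p := ⟨by rintro rfl; omega⟩
  have : NeZero q := ⟨by rintro rfl; omega⟩
  exact ⟨K, inferInstance, _, h.isCycleDecomp ha hb hpa hqb,
    h.isAnchored ha hb (zigzag_horizontal_iff_not up) hbase (existsUnique_zigzag_horizontal up)⟩

/-- Strips of height two: the number of anchors per cycle stays the same. -/
theorem anchoredDecomposable_strips {p q a b : ℕ} (hp : Even p) (hq : Even q) (ha : 0 < a)
    (hb : 0 < b) (hpa : 3 ≤ p * a) (hqb : 3 ≤ q * b) :
    AnchoredDecomposable
      (boxAnch (cyc (p * a)) (multiples (p * a) a) (cyc (q * b)) (multiples (q * b) b))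
      (multiples (p * a) a ×ˢ multiples (q * b) b) (p * (a + b)) (a + b) := by
  refine anchoredDecomposable_zigzag (isTorusPattern_zigzag_strips hp hq
    (Nat.pos_of_ne_zero (by rintro rfl; omega)) (Nat.pos_of_ne_zero (by rintro rfl; omega)))
    ha hb hpa hqb fun k => ?_
  rw [zigzag_horizontal]
  split_ifs with h <;> simp at h ⊢ <;> omega

/-- Two spirals: the number of anchors per cycle is as large as possible. -/
theorem anchoredDecomposable_spirals {p Q a b : ℕ} (hp : Even p) (ha : 0 < a)
    (hb : 0 < b) (hpa : 3 ≤ p * a) (hqb : 3 ≤ 2 * Q * b) :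
    AnchoredDecomposable
      (boxAnch (cyc (p * a)) (multiples (p * a) a) (cyc (2 * Q * b)) (multiples (2 * Q * b) b))
      (multiples (p * a) a ×ˢ multiples (2 * Q * b) b) (p * Q * (a + b)) (a + b) := by
  refine anchoredDecomposable_zigzag (isTorusPattern_zigzag_spirals hp
    (Nat.pos_of_ne_zero (by rintro rfl; omega)) (Nat.pos_of_ne_zero (by rintro rfl; omega)))
    ha hb hpa hqb fun c => ?_
  rw [zigzag_horizontal]
  cases c <;> rfl

/-! ### Translations and reflections of trajectories. -/

namespace Heading

/-- The reflection in a vertical line. -/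
def mirror : Heading → Heading
  | east => west
  | west => east
  | north => north
  | south => south

/-- The reflection in a horizontal line. -/
def flip : Heading → Heading
  | east => east
  | west => west
  | north => south
  | south => north

end Heading

theorem Run.translate {d : ℤ → ℤ → Heading} {s t : ℤ} (hd : ∀ x y, d (x + s) (y + t) = d x y)
    {x y x' y' : ℤ} {h v : ℕ} (H : Run d x y h v x' y') :
    Run d (x + s) (y + t) h v (x' + s) (y' + t) := by
  induction H with
  | refl => exact .refl
  | east _ e ih => rw [add_right_comm]; exact ih.east ((hd _ _).trans e)
  | west _ e ih => rw [sub_add_eq_add_sub]; exact ih.west ((hd _ _).trans e)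
  | north _ e ih => rw [add_right_comm]; exact ih.north ((hd _ _).trans e)
  | south _ e ih => rw [sub_add_eq_add_sub]; exact ih.south ((hd _ _).trans e)

theorem Run.glide {d : ℤ → ℤ → Heading} {s : ℤ} (hd : ∀ x y, d (x + s) (-y) = (d x y).flip)
    {x y x' y' : ℤ} {h v : ℕ} (H : Run d x y h v x' y') :
    Run d (x + s) (-y) h v (x' + s) (-y') := by
  induction H with
  | refl => exact .refl
  | east _ e ih => rw [add_right_comm]; exact ih.east (by rw [hd, e]; rfl)
  | west _ e ih => rw [sub_add_eq_add_sub]; exact ih.west (by rw [hd, e]; rfl)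
  | north _ e ih => rw [neg_add']; exact ih.south (by rw [hd, e]; rfl)
  | south _ e ih => rw [neg_sub']; exact ih.north (by rw [hd, e]; rfl)

theorem Run.mirror {d d' : ℤ → ℤ → Heading} {s t : ℤ}
    (hd : ∀ x y, d' (s - x) (y + t) = (d x y).mirror)
    {x y x' y' : ℤ} {h v : ℕ} (H : Run d x y h v x' y') :
    Run d' (s - x) (y + t) h v (s - x') (y' + t) := by
  induction H with
  | refl => exact .refl
  | east _ e ih => rw [← sub_sub]; exact ih.west (by rw [hd, e]; rfl)
  | west _ e ih => rw [← sub_add]; exact ih.east (by rw [hd, e]; rfl)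
  | north _ e ih => rw [add_right_comm]; exact ih.north (by rw [hd, e]; rfl)
  | south _ e ih => rw [sub_add_eq_add_sub]; exact ih.south (by rw [hd, e]; rfl)

/-! ### The serpent direction field and its symmetries. -/

/-- A staircase going up to the right in the columns `3` modulo `4`, with a second one going down
next to it, in coordinates that move with the staircase. -/
def staircase (x η : ℤ) : Heading :=
  if (x - 2 * ((η - 1) / 2)) % 4 = 0 then .south
  else if (x - 2 * ((η - 1) / 2)) % 4 = 3 then .north
  else if η % 2 = 1 then .east else .west

/-- One block of the direction field of `serpent`, for `0 ≤ η < 4 * N`. -/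
def serpentBlock (N x η : ℤ) : Heading :=
  if η = 0 then (if x % 2 = 0 then .east else if x % 4 = 1 then .north else .south)
  else if η < 2 * N then staircase x η
  else if η = 2 * N then
    (if x % 2 = 1 then .west else if (x - 2 * N) % 4 = 0 then .north else .south)
  else (staircase (x + 2) (4 * N - η)).flip

/-- A direction field whose trajectories are closed curves of period `4` in the first coordinate
that fill horizontal blocks of height `4 * N`: within a period, such a curve climbs through the
block and comes down again. -/
def serpent (N x y : ℤ) : Heading := serpentBlock N x (y % (4 * N))

section Serpent

variable {N : ℤ}

theorem staircase_south {x η : ℤ} (h : (x - 2 * ((η - 1) / 2)) % 4 = 0) :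
    staircase x η = .south := if_pos h

theorem staircase_north {x η : ℤ} (h : (x - 2 * ((η - 1) / 2)) % 4 = 3) :
    staircase x η = .north := by
  rw [staircase, if_neg (by omega), if_pos h]

theorem staircase_east {x η : ℤ}
    (h : (x - 2 * ((η - 1) / 2)) % 4 = 1 ∨ (x - 2 * ((η - 1) / 2)) % 4 = 2) (hη : η % 2 = 1) :
    staircase x η = .east := by
  rw [staircase, if_neg (by omega), if_neg (by omega), if_pos hη]

theorem staircase_west {x η : ℤ}
    (h : (x - 2 * ((η - 1) / 2)) % 4 = 1 ∨ (x - 2 * ((η - 1) / 2)) % 4 = 2) (hη : η % 2 = 0) :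
    staircase x η = .west := by
  rw [staircase, if_neg (by omega), if_neg (by omega), if_neg (by omega)]

theorem staircase_add_four (x η : ℤ) : staircase (x + 4) η = staircase x η := by
  have : (x + 4 - 2 * ((η - 1) / 2)) % 4 = (x - 2 * ((η - 1) / 2)) % 4 := by omega
  rw [staircase, staircase, this]

theorem serpent_of_lower {x y : ℤ} (h₀ : 0 < y) (h₁ : y < 2 * N) :
    serpent N x y = staircase x y := by
  rw [serpent, Int.emod_eq_of_lt (by omega) (by omega), serpentBlock, if_neg (by omega), if_pos h₁]

theorem serpent_of_upper {x y : ℤ} (h₀ : 2 * N < y) (h₁ : y < 4 * N) :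
    serpent N x y = (staircase (x + 2) (4 * N - y)).flip := by
  rw [serpent, Int.emod_eq_of_lt (by omega) (by omega), serpentBlock, if_neg (by omega),
    if_neg (by omega), if_neg (by omega)]

theorem serpent_zero (x : ℤ) :
    serpent N x 0 = if x % 2 = 0 then .east else if x % 4 = 1 then .north else .south := by
  rw [serpent, Int.zero_emod, serpentBlock, if_pos rfl]

theorem serpent_middle (hN : 0 < N) (x : ℤ) :
    serpent N x (2 * N) =
      if x % 2 = 1 then .west else if (x - 2 * N) % 4 = 0 then .north else .south := by
  rw [serpent, Int.emod_eq_of_lt (by omega) (by omega), serpentBlock, if_neg (by omega),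
    if_neg (by omega), if_pos rfl]

theorem serpent_add_mul (x y k : ℤ) : serpent N x (y + 4 * N * k) = serpent N x y := by
  rw [serpent, Int.add_mul_emod_self_left, serpent]

theorem serpent_add_four (x y : ℤ) : serpent N (x + 4) y = serpent N x y := by
  unfold serpent serpentBlock
  rw [staircase_add_four, add_right_comm, staircase_add_four, Int.add_emod_right,
    show (x + 4) % 2 = x % 2 by omega, show (x + 4 - 2 * N) % 4 = (x - 2 * N) % 4 by omega]

theorem serpent_add_four_mul (x y k : ℤ) : serpent N (x + 4 * k) y = serpent N x y := by
  have := Function.Periodic.int_mul (f := fun x => serpent N x y) (c := 4)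
    (fun x => serpent_add_four x y) k x
  rw [mul_comm]
  simpa using this

theorem serpent_translate (k l x y : ℤ) :
    serpent N (x + 4 * k) (y + 4 * N * l) = serpent N x y := by
  rw [serpent_add_four_mul, serpent_add_mul]

theorem Heading.flip_flip (θ : Heading) : θ.flip.flip = θ := by
  cases θ <;> rfl

/-- The upper half of a block is defined as the glide image of the lower half. Only the rows `0` and
`2 * N`, which the reflection preserves modulo `4 * N`, need a separate check. -/
theorem serpent_glide (hN : 0 < N) (x y : ℤ) : serpent N (x + 2) (-y) = (serpent N x y).flip := by
  have hy := Int.emod_nonneg y (b := 4 * N) (by omega)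
  have hy' := Int.emod_lt_of_pos y (b := 4 * N) (by omega)
  have e := Int.mul_ediv_add_emod y (4 * N)
  generalize y / (4 * N) = k at e
  generalize y % (4 * N) = η at hy hy' e
  have e₁ : serpent N x y = serpent N x η := by
    rw [← e, add_comm, serpent_add_mul]
  have e₂ : serpent N (x + 2) (-y) = serpent N (x + 2) (-η) := by
    rw [← serpent_add_mul (x + 2) (-η) (-k)]
    congr 1
    rw [← e]
    ring
  have e₃ : serpent N (x + 2) (-η) = serpent N (x + 2) (4 * N - η) := by
    rw [← serpent_add_mul (x + 2) (-η) 1]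
    congr 1
    ring
  rw [e₁, e₂]
  rcases hy.eq_or_lt with rfl | h₀
  · rw [neg_zero, serpent_zero, serpent_zero]
    rcases (by omega : x % 4 = 0 ∨ x % 4 = 1 ∨ x % 4 = 2 ∨ x % 4 = 3) with h | h | h | h
    · rw [if_pos (by omega), if_pos (by omega)]; rfl
    · rw [if_neg (by omega), if_neg (by omega), if_neg (by omega), if_pos (by omega)]; rfl
    · rw [if_pos (by omega), if_pos (by omega)]; rfl
    · rw [if_neg (by omega), if_pos (by omega), if_neg (by omega), if_neg (by omega)]; rfl
  rw [e₃]
  rcases lt_trichotomy η (2 * N) with h | rfl | h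
  · rw [serpent_of_lower h₀ h, serpent_of_upper (by omega) (by omega), sub_sub_cancel,
      show x + 2 + 2 = x + 4 by ring, staircase_add_four]
  · rw [show 4 * N - 2 * N = 2 * N by ring, serpent_middle hN, serpent_middle hN]
    rcases (by omega : x % 2 = 1 ∨ x % 2 = 0 ∧ (x - 2 * N) % 4 = 0 ∨
      x % 2 = 0 ∧ (x - 2 * N) % 4 = 2) with h | ⟨h, h'⟩ | ⟨h, h'⟩
    · rw [if_pos (by omega), if_pos (by omega)]; rfl
    · rw [if_neg (by omega), if_neg (by omega), if_neg (by omega), if_pos (by omega)]; rfl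
    · rw [if_neg (by omega), if_pos (by omega), if_neg (by omega), if_neg (by omega)]; rfl
  · rw [serpent_of_lower (by omega) (by omega), serpent_of_upper h hy', Heading.flip_flip]

end Serpent

/-! ### The trajectories of the serpent. -/

section SerpentRuns

variable {N : ℕ}

theorem serpent_run_two_east {i h v : ℕ} (hi : i < N) {x y : ℤ}
    (H : Run (serpent N) x y h v (1 + 2 * i) (1 + 2 * i)) :
    Run (serpent N) x y (h + 1) v (2 + 2 * i) (1 + 2 * i) ∧
      Run (serpent N) x y (h + 2) v (3 + 2 * i) (1 + 2 * i) := by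
  have h₁ : Run (serpent N) x y (h + 1) v (2 + 2 * i) (1 + 2 * i) := by
    have := H.east (by
      rw [serpent_of_lower (by omega) (by omega), staircase_east (by omega) (by omega)])
    convert this using 1
    ring
  refine ⟨h₁, ?_⟩
  have := h₁.east (by
    rw [serpent_of_lower (by omega) (by omega), staircase_east (by omega) (by omega)])
  convert this using 1
  ring

theorem serpent_run_north {i h v : ℕ} (hi : i < N) {x y : ℤ}
    (H : Run (serpent N) x y h v (1 + 2 * i) (1 + 2 * i)) :
    Run (serpent N) x y (h + 2) (v + 1) (3 + 2 * i) (2 + 2 * i) := by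
  have := (serpent_run_two_east hi H).2.north (by
    rw [serpent_of_lower (by omega) (by omega), staircase_north (by omega)])
  convert this using 1
  ring

/-- The way up through the lower half of a block. -/
theorem serpent_climb {i : ℕ} (hi : i < N) :
    Run (serpent N) 0 0 (1 + 2 * i) (1 + 2 * i) (1 + 2 * i) (1 + 2 * i) := by
  induction i with
  | zero =>
    have h₁ := (Run.refl (d := serpent N) (x := 0) (y := 0)).east (by rw [serpent_zero]; simp)
    exact h₁.north (by rw [serpent_zero]; simp)
  | succ i ih =>
    have := (serpent_run_north (by omega) (ih (by omega))).north (by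
      rw [serpent_of_lower (by omega) (by omega), staircase_north (by omega)])
    convert this using 1 <;> push_cast <;> ring

/-- The way from the lower to the upper half of a block. -/
theorem serpent_turn (hN : 0 < N) :
    Run (serpent N) 0 0 (2 * N + 1) (2 * N) (2 * N + 1) (2 * N) ∧
    Run (serpent N) 0 0 (2 * N + 2) (2 * N) (2 * N) (2 * N) ∧
    Run (serpent N) 0 0 (2 * N + 2) (2 * N + 1) (2 * N) (2 * N + 1) ∧
    Run (serpent N) 0 0 (2 * N + 2) (2 * N + 2) (2 * N) (2 * N + 2) := by
  obtain ⟨n, rfl⟩ : ∃ n, N = n + 1 := ⟨N - 1, by omega⟩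
  have h₁ : Run (serpent (n + 1 : ℕ)) 0 0 (2 * (n + 1) + 1) (2 * (n + 1))
      (2 * (n + 1 : ℕ) + 1) (2 * (n + 1 : ℕ)) := by
    have := serpent_run_north (by omega) (serpent_climb (N := n + 1) (i := n) (by omega))
    convert this using 1 <;> push_cast <;> ring
  have h₂ : Run (serpent (n + 1 : ℕ)) 0 0 (2 * (n + 1) + 2) (2 * (n + 1))
      (2 * (n + 1 : ℕ)) (2 * (n + 1 : ℕ)) := by
    have := h₁.west (by rw [serpent_middle (by omega), if_pos (by omega)])
    convert this using 1
    ring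
  have h₃ := h₂.north (by
    rw [serpent_middle (by omega), if_neg (by omega), if_pos (by omega)])
  have h₄ := h₃.north (by
    rw [serpent_of_upper (by omega) (by omega)]
    rcases n with _ | n
    · rw [staircase_south (by omega)]; rfl
    · rw [staircase_south (by omega)]; rfl)
  refine ⟨h₁, h₂, h₃, ?_⟩
  convert h₄ using 1
  ring

theorem serpent_run_two_west {i h v : ℕ} (hi : i + 1 < N) {x y : ℤ}
    (H : Run (serpent N) x y h v (2 * N - 2 * i) (2 * N + 2 + 2 * i)) :
    Run (serpent N) x y (h + 1) v (2 * N - 2 * i - 1) (2 * N + 2 + 2 * i) ∧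
      Run (serpent N) x y (h + 2) v (2 * N - 2 * i - 2) (2 * N + 2 + 2 * i) ∧
      Run (serpent N) x y (h + 2) (v + 1) (2 * N - 2 * i - 2) (2 * N + 3 + 2 * i) := by
  have h₁ := H.west (by
    rw [serpent_of_upper (by omega) (by omega), staircase_west (by omega) (by omega)]; rfl)
  have h₂ : Run (serpent N) x y (h + 2) v (2 * N - 2 * i - 2) (2 * N + 2 + 2 * i) := by
    have := h₁.west (by
      rw [serpent_of_upper (by omega) (by omega), staircase_west (by omega) (by omega)]; rfl)
    convert this using 1
    ring
  refine ⟨h₁, h₂, ?_⟩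
  have := h₂.north (by
    rw [serpent_of_upper (by omega) (by omega), staircase_south (by omega)]; rfl)
  convert this using 1
  ring

/-- The way up through the upper half of a block. -/
theorem serpent_climb_back {i : ℕ} (hi : i < N) :
    Run (serpent N) 0 0 (2 * N + 2 + 2 * i) (2 * N + 2 + 2 * i)
      (2 * N - 2 * i) (2 * N + 2 + 2 * i) := by
  induction i with
  | zero => simpa using (serpent_turn hi).2.2.2
  | succ i ih =>
    have := (serpent_run_two_west (by omega) (ih (by omega))).2.2.north (by
      rw [serpent_of_upper (by omega) (by omega), staircase_south (by omega)]; rfl)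
    convert this using 1 <;> push_cast <;> ring

/-- The block is climbed with 2N + 1 steps to the right and then 2N - 1 to the left, a net shift of
2. -/
theorem serpent_half_period (hN : 0 < N) :
    Run (serpent N) 0 0 (4 * N) (4 * N) 2 (4 * N) := by
  obtain ⟨n, rfl⟩ : ∃ n, N = n + 1 := ⟨N - 1, by omega⟩
  have := serpent_climb_back (N := n + 1) (i := n) (by omega)
  convert this using 1 <;> push_cast <;> ring

/-- The glide reflection followed by a shift by one block height takes the origin to the end of the
half period, so the image of a run from the origin continues that half period. -/
theorem serpent_reflect (hN : 0 < N) {h v : ℕ} {x y : ℤ} (H : Run (serpent N) 0 0 h v x y) :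
    Run (serpent N) 0 0 (4 * N + h) (4 * N + v) (x + 2) (4 * N - y) := by
  have h₁ := H.glide (s := 2) (serpent_glide (by omega))
  have h₂ := h₁.translate (s := 4 * 0) (t := 4 * N * 1) (serpent_translate 0 1)
  have h₃ := (serpent_half_period hN).trans (by simpa using h₂)
  convert h₃ using 1
  ring

theorem serpent_period (hN : 0 < N) (n : ℕ) :
    Run (serpent N) 0 0 (8 * N * n) (8 * N * n) (4 * n) 0 := by
  induction n with
  | zero => simpa using Run.refl
  | succ n ih =>
    have h₁ := serpent_reflect hN (serpent_half_period hN)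
    have h₂ := h₁.translate (s := 4 * n) (t := 4 * N * 0) (serpent_translate n 0)
    have h₃ := ih.trans (by simpa using h₂)
    convert h₃ using 1 <;> push_cast <;> ring

/-- The points that are reached in the first half of the period. -/
def serpentOutward (N x η : ℤ) : Prop :=
  if η = 0 then x % 4 = 0 ∨ x % 4 = 1
  else if η < 2 * N then
    (if η % 2 = 1 then (x - η) % 4 = 0 ∨ (x - η) % 4 = 1 ∨ (x - η) % 4 = 2 else (x - η) % 4 = 1)
  else if η = 2 * N then (x - η) % 4 = 0 ∨ (x - η) % 4 = 1
  else if η % 2 = 1 then (x + η) % 4 = 1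
  else (x + η) % 4 = 0 ∨ (x + η) % 4 = 1 ∨ (x + η) % 4 = 2

/-- The points on the way up and their glide images on the way down exhaust the block. -/
theorem serpentOutward_or {x η : ℤ} (h₁ : η < 4 * N) :
    serpentOutward N x η ∨ serpentOutward N (x + 2) (if η = 0 then 0 else 4 * N - η) := by
  unfold serpentOutward
  split_ifs <;> omega

theorem exists_run_of_serpentOutward {x η : ℤ} (h₀ : 0 ≤ η) (h₁ : η < 4 * N)
    (H : serpentOutward N x η) :
    ∃ k : ℤ, ∃ h v, Run (serpent N) 0 0 h v (x + 4 * k) η := by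
  have hN : 0 < N := by omega
  have key : ∀ {x' : ℤ} {h v : ℕ}, Run (serpent N) 0 0 h v x' η → (x' - x) % 4 = 0 →
      ∃ k : ℤ, ∃ h v, Run (serpent N) 0 0 h v (x + 4 * k) η := fun {x' h v} hr hx =>
    ⟨(x' - x) / 4, h, v, by rwa [show x + 4 * ((x' - x) / 4) = x' by omega]⟩
  unfold serpentOutward at H
  split_ifs at H with c₁ c₂ c₃ c₄ c₅
  · subst c₁
    rcases H with H | H
    · exact key Run.refl (by omega)
    · exact key (Run.refl.east (by rw [serpent_zero]; simp)) (by omega)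
  · obtain ⟨i, hi⟩ : ∃ i : ℕ, η = 1 + 2 * i := ⟨((η - 1) / 2).toNat, by omega⟩
    subst hi
    have hr := serpent_climb (N := N) (i := i) (by omega)
    rcases H with H | H | H
    · exact key hr (by omega)
    · exact key (serpent_run_two_east (by omega) hr).1 (by omega)
    · exact key (serpent_run_two_east (by omega) hr).2 (by omega)
  · obtain ⟨i, hi⟩ : ∃ i : ℕ, η = 2 + 2 * i := ⟨((η - 2) / 2).toNat, by omega⟩
    subst hi
    exact key (serpent_run_north (by omega) (serpent_climb (N := N) (i := i) (by omega)))
      (by omega)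
  · subst c₄
    rcases H with H | H
    · exact key (serpent_turn hN).2.1 (by omega)
    · exact key (serpent_turn hN).1 (by omega)
  · obtain ⟨i, hi⟩ : ∃ i : ℕ, η = 2 * N + 1 + 2 * i := ⟨((η - 2 * N - 1) / 2).toNat, by omega⟩
    subst hi
    rcases i with _ | i
    · exact key (by simpa using (serpent_turn hN).2.2.1) (by push_cast at H; omega)
    · push_cast at h₁ H key ⊢
      rw [show (2 * N + 1 + 2 * (i + 1) : ℤ) = 2 * N + 3 + 2 * i by ring] at *
      exact key (serpent_run_two_west (by omega) (serpent_climb_back (i := i) (by omega))).2.2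
        (by omega)
  · obtain ⟨i, hi⟩ : ∃ i : ℕ, η = 2 * N + 2 + 2 * i := ⟨((η - 2 * N - 2) / 2).toNat, by omega⟩
    subst hi
    have hr := serpent_climb_back (N := N) (i := i) (by omega)
    rcases H with H | H | H
    · exact key (serpent_run_two_west (by omega) hr).2.1 (by omega)
    · exact key (serpent_run_two_west (by omega) hr).1 (by omega)
    · exact key hr (by omega)

theorem exists_serpent_run (hN : 0 < N) (x y : ℤ) :
    ∃ k l : ℤ, ∃ h v, Run (serpent N) 0 0 h v (x + 4 * k) (y + 4 * N * l) := by
  have hy := Int.emod_nonneg y (b := 4 * N) (by omega)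
  have hy' := Int.emod_lt_of_pos y (b := 4 * (N : ℤ)) (by omega)
  have e := Int.mul_ediv_add_emod y (4 * N)
  generalize y / (4 * N) = l at e
  generalize y % (4 * N) = η at hy hy' e
  subst e
  rcases serpentOutward_or (x := x) hy' with H | H
  · obtain ⟨k, h, v, hr⟩ := exists_run_of_serpentOutward hy hy' H
    refine ⟨k, -l, h, v, ?_⟩
    convert hr using 1
    ring
  · obtain ⟨k, h, v, hr⟩ := exists_run_of_serpentOutward (by split_ifs <;> omega)
      (by split_ifs <;> omega) H
    have := serpent_reflect hN hr
    -- The reflection sends row `0` to row `4 * N`, which accounts for one additional block.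
    split_ifs at this with h0
    · refine ⟨k + 1, 1 - l, 4 * N + h, 4 * N + v, ?_⟩
      convert this using 1
      · ring
      · rw [h0]
        ring
    · refine ⟨k + 1, -l, 4 * N + h, 4 * N + v, ?_⟩
      convert this using 1 <;> ring

end SerpentRuns

/-! ### The edges used by the serpent and by its mirror image. -/

section SerpentEdges

variable {N : ℤ}

/-- The horizontal edge to the right of `(x, y)` is used by `serpent`. -/
def SerpentRight (N x y : ℤ) : Prop := serpent N x y = .east ∨ serpent N (x + 1) y = .west

/-- The vertical edge above `(x, y)` is used by `serpent`. -/
def SerpentAbove (N x y : ℤ) : Prop := serpent N x y = .north ∨ serpent N x (y + 1) = .south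

theorem serpentRight_of_bottom {x : ℤ} (hx : x % 2 = 0) : SerpentRight N x 0 :=
  Or.inl (by rw [serpent_zero, if_pos hx])

theorem serpentRight_of_middle (hN : 0 < N) {x : ℤ} (hx : x % 2 = 0) :
    SerpentRight N x (2 * N) :=
  Or.inr (by rw [serpent_middle hN, if_pos (by omega)])

theorem serpentRight_of_lower {x η : ℤ} (h₀ : 0 < η) (h₁ : η < 2 * N)
    (h : η % 2 = 1 ∧ ((x - η) % 4 = 0 ∨ (x - η) % 4 = 1) ∨
      η % 2 = 0 ∧ ((x - η) % 4 = 2 ∨ (x - η) % 4 = 3)) : SerpentRight N x η := by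
  rcases h with ⟨h, h'⟩ | ⟨h, h'⟩
  · exact Or.inl (by rw [serpent_of_lower h₀ h₁, staircase_east (by omega) h])
  · exact Or.inr (by rw [serpent_of_lower h₀ h₁, staircase_west (by omega) h])

theorem serpentRight_of_upper {x η : ℤ} (h₀ : 2 * N < η) (h₁ : η < 4 * N)
    (h : η % 2 = 1 ∧ ((x + η) % 4 = 2 ∨ (x + η) % 4 = 3) ∨
      η % 2 = 0 ∧ ((x + η) % 4 = 0 ∨ (x + η) % 4 = 1)) : SerpentRight N x η := by
  rcases h with ⟨h, h'⟩ | ⟨h, h'⟩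
  · exact Or.inl (by rw [serpent_of_upper h₀ h₁, staircase_east (by omega) (by omega)]; rfl)
  · exact Or.inr (by rw [serpent_of_upper h₀ h₁, staircase_west (by omega) (by omega)]; rfl)

theorem serpentAbove_of_bottom (hN : 0 < N) {x : ℤ} (hx : x % 4 = 0 ∨ x % 4 = 1) :
    SerpentAbove N x 0 := by
  rcases hx with hx | hx
  · exact Or.inr (by rw [serpent_of_lower (by omega) (by omega), staircase_south (by omega)])
  · exact Or.inl (by rw [serpent_zero, if_neg (by omega), if_pos hx])

theorem serpentAbove_of_lower {x η : ℤ} (h₀ : 0 < η) (h₁ : η < 2 * N - 1)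
    (h : η % 2 = 1 ∧ ((x - η) % 4 = 3 ∨ (x - η) % 4 = 2) ∨
      η % 2 = 0 ∧ ((x - η) % 4 = 0 ∨ (x - η) % 4 = 1)) : SerpentAbove N x η := by
  rcases h with ⟨h, h' | h'⟩ | ⟨h, h' | h'⟩
  · exact Or.inr (by rw [serpent_of_lower (by omega) (by omega), staircase_south (by omega)])
  · exact Or.inl (by rw [serpent_of_lower (by omega) (by omega), staircase_north (by omega)])
  · exact Or.inr (by rw [serpent_of_lower (by omega) (by omega), staircase_south (by omega)])
  · exact Or.inl (by rw [serpent_of_lower (by omega) (by omega), staircase_north (by omega)])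

theorem serpentAbove_of_below_middle (hN : 0 < N) {x : ℤ}
    (hx : (x - 2 * N) % 4 = 1 ∨ (x - 2 * N) % 4 = 2) : SerpentAbove N x (2 * N - 1) := by
  rcases hx with hx | hx
  · exact Or.inl (by rw [serpent_of_lower (by omega) (by omega), staircase_north (by omega)])
  · exact Or.inr (by
      rw [sub_add_cancel, serpent_middle hN, if_neg (by omega), if_neg (by omega)])

theorem serpentAbove_reflect (hN : 0 < N) {x y : ℤ} (h : SerpentAbove N (x + 2) (4 * N - y - 1)) :
    SerpentAbove N x y := by
  have e : ∀ y, serpent N x y = (serpent N (x + 2) (4 * N - y)).flip := fun y => by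
    have h₁ := serpent_glide hN x y
    have h₂ := serpent_add_mul (N := N) (x + 2) (-y) 1
    rw [show -y + 4 * N * 1 = 4 * N - y by ring] at h₂
    rw [h₂, h₁, Heading.flip_flip]
  rcases h with h | h
  · exact Or.inr (by rw [e, ← sub_sub, h]; rfl)
  · exact Or.inl (by rw [e, show 4 * N - y = 4 * N - y - 1 + 1 by ring, h]; rfl)

theorem serpentRight_congr {x y y' k : ℤ} (hk : y' = y + 4 * N * k) :
    SerpentRight N x y' ↔ SerpentRight N x y := by
  rw [SerpentRight, hk, serpent_add_mul, serpent_add_mul, SerpentRight]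

theorem serpentAbove_congr {x y y' k : ℤ} (hk : y' = y + 4 * N * k) :
    SerpentAbove N x y' ↔ SerpentAbove N x y := by
  rw [SerpentAbove, hk, add_right_comm, serpent_add_mul, serpent_add_mul, SerpentAbove]

/-- The second colour arises by reflecting columns by x ↦ 2N + 2 - x and shifting by half a block.
An edge given by its left end therefore corresponds to the one at 2N + 1 - x. The shift exchanges
the two halves of a block, and the edge patterns of the halves complement each other. -/
theorem serpentRight_or (hN : 0 < N) (x y : ℤ) :
    SerpentRight N x y ∨ SerpentRight N (2 * N + 1 - x) (y - 2 * N) := by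
  have hy := Int.emod_nonneg y (b := 4 * N) (by omega)
  have hy' := Int.emod_lt_of_pos y (b := 4 * N) (by omega)
  have e := Int.mul_ediv_add_emod y (4 * N)
  generalize y / (4 * N) = l at e
  generalize y % (4 * N) = η at hy hy' e
  rw [serpentRight_congr (y := η) (k := l) (by rw [← e]; ring)]
  rcases (by omega : η = 0 ∨ 0 < η ∧ η < 2 * N ∨ η = 2 * N ∨ 2 * N < η) with rfl | ⟨h, h'⟩ | rfl | h
  · rw [serpentRight_congr (y := 2 * N) (y' := y - 2 * N) (k := l - 1)
      (by rw [← e]; ring)]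
    rcases Int.emod_two_eq x with h | h
    · exact Or.inl (serpentRight_of_bottom h)
    · exact Or.inr (serpentRight_of_middle hN (by omega))
  · rw [serpentRight_congr (y := η + 2 * N) (y' := y - 2 * N) (k := l - 1)
      (by rw [← e]; ring)]
    by_cases c : η % 2 = 1 ∧ ((x - η) % 4 = 0 ∨ (x - η) % 4 = 1) ∨
      η % 2 = 0 ∧ ((x - η) % 4 = 2 ∨ (x - η) % 4 = 3)
    · exact Or.inl (serpentRight_of_lower h h' c)
    · exact Or.inr (serpentRight_of_upper (by omega) (by omega) (by omega))
  · rw [serpentRight_congr (y := 0) (y' := y - 2 * N) (k := l)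
      (by rw [← e]; ring)]
    rcases Int.emod_two_eq x with h | h
    · exact Or.inl (serpentRight_of_middle hN h)
    · exact Or.inr (serpentRight_of_bottom (by omega))
  · rw [serpentRight_congr (y := η - 2 * N) (y' := y - 2 * N) (k := l)
      (by rw [← e]; ring)]
    by_cases c : η % 2 = 1 ∧ ((x + η) % 4 = 2 ∨ (x + η) % 4 = 3) ∨
      η % 2 = 0 ∧ ((x + η) % 4 = 0 ∨ (x + η) % 4 = 1)
    · exact Or.inl (serpentRight_of_upper h hy' c)
    · exact Or.inr (serpentRight_of_lower (by omega) (by omega) (by omega))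

/-- The columns in which `serpent` uses the vertical edge above row `η`, for `0 ≤ η < 2 * N`. -/
def serpentColumns (N x η : ℤ) : Prop :=
  if η = 0 then x % 4 = 0 ∨ x % 4 = 1
  else if η = 2 * N - 1 then (x - 2 * N) % 4 = 1 ∨ (x - 2 * N) % 4 = 2
  else if η % 2 = 1 then (x - η) % 4 = 3 ∨ (x - η) % 4 = 2
  else (x - η) % 4 = 0 ∨ (x - η) % 4 = 1

theorem serpentAbove_of_columns {x η : ℤ} (h₀ : 0 ≤ η) (h₁ : η < 2 * N)
    (h : serpentColumns N x η) : SerpentAbove N x η := by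
  unfold serpentColumns at h
  split_ifs at h with c₁ c₂ c₃
  · exact c₁ ▸ serpentAbove_of_bottom (by omega) h
  · exact c₂ ▸ serpentAbove_of_below_middle (by omega) h
  · exact serpentAbove_of_lower (by omega) (by omega) (by omega)
  · exact serpentAbove_of_lower (by omega) (by omega) (by omega)

/-- Whichever of the two edges lies in the upper half of its block is moved to the lower half by the
glide reflection. There `serpentColumns` selects two of every four columns, and the two selections
are complementary. -/
theorem serpentAbove_or (hN : 0 < N) (x y : ℤ) :
    SerpentAbove N x y ∨ SerpentAbove N (2 * N + 2 - x) (y - 2 * N) := by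
  have hy := Int.emod_nonneg y (b := 4 * N) (by omega)
  have hy' := Int.emod_lt_of_pos y (b := 4 * N) (by omega)
  have e := Int.mul_ediv_add_emod y (4 * N)
  generalize y / (4 * N) = l at e
  generalize y % (4 * N) = η at hy hy' e
  rw [serpentAbove_congr (y := η) (k := l) (by rw [← e]; ring)]
  rcases lt_or_ge η (2 * N) with h | h
  · rw [serpentAbove_congr (y := η + 2 * N) (y' := y - 2 * N) (k := l - 1)
      (by rw [← e]; ring)]
    suffices serpentColumns N x η ∨ serpentColumns N (2 * N + 2 - x + 2) (2 * N - η - 1) by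
      refine this.imp (serpentAbove_of_columns hy h) fun H => serpentAbove_reflect hN ?_
      convert serpentAbove_of_columns (by omega) (by omega) H using 1
      ring
    unfold serpentColumns
    split_ifs <;> omega
  · rw [serpentAbove_congr (y := η - 2 * N) (y' := y - 2 * N) (k := l)
      (by rw [← e]; ring)]
    suffices serpentColumns N (x + 2) (4 * N - η - 1) ∨
        serpentColumns N (2 * N + 2 - x) (η - 2 * N) by
      exact this.imp (fun H => serpentAbove_reflect hN
        (serpentAbove_of_columns (by omega) (by omega) H))
        (serpentAbove_of_columns (by omega) (by omega))
    unfold serpentColumns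
    split_ifs <;> omega

end SerpentEdges

/-! ### The serpent torus pattern. -/

/-- The second colour of the pattern given by `serpent`. -/
def serpentMirror (N x y : ℤ) : Heading := (serpent N (2 * N + 2 - x) (y - 2 * N)).mirror

theorem serpentMirror_run {N : ℤ} {x y x' y' : ℤ} {h v : ℕ}
    (H : Run (serpent N) x y h v x' y') :
    Run (serpentMirror N) (2 * N + 2 - x) (y + 2 * N) h v (2 * N + 2 - x') (y' + 2 * N) :=
  H.mirror fun x y => by rw [serpentMirror, sub_sub_cancel, add_sub_cancel_right]

/-- The direction fields of the serpent pattern. -/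
def serpentField (N : ℤ) : Bool → ℤ → ℤ → Heading
  | false => serpent N
  | true => serpentMirror N

/-- Each of the `B` blocks carries one curve of each colour. Around the torus this curve makes `P`
periods, each with 8N horizontal and 8N vertical steps; 2B curves with 8NP such steps match the 4P *
4NB grid points. -/
theorem isTorusPattern_serpent {N P B : ℕ} (hN : 0 < N) (hP : 0 < P) (hB : 0 < B) :
    IsTorusPattern (4 * P) (4 * N * B) (4 * P * (2 * N)) (serpentField N)
      (fun k : Bool × Fin B =>
        (k.1, if k.1 then 2 * N + 2 else 0, 4 * N * k.2 + if k.1 then 2 * N else 0)) := by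
  have hrun : ∀ (x y : ℤ), ∃ (j : Fin B) (h v : ℕ) (x' y' : ℤ),
      Run (serpent N) 0 (4 * N * j) h v x' y' ∧
      (x' : ZMod (4 * P)) = (x : ZMod (4 * P)) ∧
      (y' : ZMod (4 * N * B)) = (y : ZMod (4 * N * B)) := by
    intro x y
    obtain ⟨k, l, h, v, hr⟩ := exists_serpent_run hN x y
    have hj := Int.emod_nonneg (-l) (b := (B : ℤ)) (by omega)
    have hj' := Int.emod_lt_of_pos (-l) (b := (B : ℤ)) (by omega)
    have ej := Int.mul_ediv_add_emod (-l) (B : ℤ)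
    have hm := Int.emod_nonneg (-k) (b := (P : ℤ)) (by omega)
    have em := Int.mul_ediv_add_emod (-k) (P : ℤ)
    generalize hj0 : (-l) % (B : ℤ) = j at hj hj' ej
    generalize hm0 : (-k) % (P : ℤ) = m at hm em
    lift j to ℕ using hj
    lift m to ℕ using hm
    -- Runs only go forward, so the shift by 4k is undone by `m` full periods with m ≡ -k modulo
    -- `P`.
    have h₁ := (serpent_period hN m).trans
      (by simpa using hr.translate (s := 4 * m) (t := 4 * N * 0) (serpent_translate m 0))
    have h₂ := h₁.translate (s := 4 * 0) (t := 4 * N * j) (serpent_translate 0 j)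
    refine ⟨⟨j, by omega⟩, _, _, _, _, by simpa using h₂, ?_, ?_⟩
    · rw [ZMod.intCast_eq_intCast_iff_dvd_sub]
      exact ⟨-k / P, by push_cast; linear_combination (-4 : ℤ) * em⟩
    · rw [ZMod.intCast_eq_intCast_iff_dvd_sub]
      exact ⟨-l / B, by push_cast; linear_combination (-4 * N : ℤ) * ej⟩
  have hret : ∀ j : Fin B, Run (serpent N) 0 (4 * N * j) (4 * P * (2 * N)) (4 * P * (2 * N))
      (4 * P) (4 * N * j) := fun j => by
    have := (serpent_period hN P).translate (s := 4 * 0) (t := 4 * N * (j : ℕ))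
      (serpent_translate 0 _)
    convert this using 1 <;> ring
  refine ⟨?_, ?_, fun x y => ?_, fun x y => ?_, ?_, ?_, ?_⟩
  · intro c x y
    have h : ∀ x y k : ℤ, serpent N (x + 4 * P * k) y = serpent N x y := fun x y k => by
      rw [mul_assoc, serpent_add_four_mul]
    cases c
    · simpa [serpentField] using h x y 1
    · have := h (2 * N + 2 - x) (y - 2 * N) (-1)
      simp only [serpentField, serpentMirror]
      rw [← this]
      congr 2
      push_cast
      ring
  · intro c x y
    cases c
    · simpa [serpentField] using serpent_add_mul (N := N) x y B
    · have := serpent_add_mul (N := N) (2 * N + 2 - x) (y - 2 * N) B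
      simp only [serpentField, serpentMirror]
      rw [← this]
      congr 2
      push_cast
      ring
  · rcases serpentRight_or (N := N) (by omega) x y with h | h | h
    · exact ⟨false, h⟩
    · refine ⟨true, Or.inr ?_⟩
      rw [serpentField, serpentMirror, show (2 * N + 2 - (x + 1) : ℤ) = 2 * N + 1 - x by ring, h]
      rfl
    · refine ⟨true, Or.inl ?_⟩
      rw [serpentField, serpentMirror, show (2 * N + 2 - x : ℤ) = 2 * N + 1 - x + 1 by ring, h]
      rfl
  · rcases serpentAbove_or (N := N) (by omega) x y with h | h | h
    · exact ⟨false, h⟩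
    · refine ⟨true, Or.inl ?_⟩
      rw [serpentField, serpentMirror, h]
      rfl
    · refine ⟨true, Or.inr ?_⟩
      rw [serpentField, serpentMirror, show (y + 1 - 2 * N : ℤ) = y - 2 * N + 1 by ring, h]
      rfl
  · intro c x y
    cases c
    · obtain ⟨j, h, v, x', y', hr, hx, hy⟩ := hrun x y
      exact ⟨(false, j), h, v, x', y', rfl, by simpa [serpentField] using hr, hx, hy⟩
    · obtain ⟨j, h, v, x', y', hr, hx, hy⟩ := hrun (2 * N + 2 - x) (y - 2 * N)
      refine ⟨(true, j), h, v, _, _, rfl,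
        by simpa [serpentField] using serpentMirror_run hr, ?_, ?_⟩
      · push_cast at hx ⊢
        rw [hx]
        ring
      · push_cast at hy ⊢
        rw [hy]
        ring
  · rintro ⟨c, j⟩
    have h4 := ZMod.natCast_self (4 * P)
    push_cast at h4
    cases c
    · exact ⟨_, _, by simpa [serpentField] using hret j, by push_cast; simpa using h4, by simp⟩
    · refine ⟨_, _, by simpa [serpentField] using serpentMirror_run (hret j), ?_, by simp⟩
      push_cast
      rw [h4]
      simp
  · simp
    ring

/-- Serpents: intermediate cycle lengths. -/
theorem cycleDecomposable_serpents {N P B a b : ℕ} (hN : 0 < N) (hP : 0 < P) (hB : 0 < B)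
    (ha : 0 < a) (hb : 0 < b) :
    CycleDecomposable
      (boxAnch (cyc (4 * P * a)) (multiples (4 * P * a) a)
        (cyc (4 * N * B * b)) (multiples (4 * N * B * b) b)) (4 * P * (2 * N) * (a + b)) := by
  have : NeZero (4 * P) := ⟨by positivity⟩
  have : NeZero (4 * N * B) := ⟨by positivity⟩
  have h₁ : 0 < P * a := by positivity
  have h₂ : 0 < N * B * b := by positivity
  exact ⟨Bool × Fin B, inferInstance, _, (isTorusPattern_serpent hN hP hB).isCycleDecomp ha hb
    (by linarith) (by linarith)⟩

/-! ### Transport of decompositions and multiplication by one factor at a time. -/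

theorem AnchoredDecomposable.map {V W : Type} {G : SimpleGraph V} {S : Set V}
    {H : SimpleGraph W} {T : Set W} {ℓ m : ℕ} (h : AnchoredDecomposable G S ℓ m) (φ : V → W)
    (D : Set V) (hD : ∀ u v, G.Adj u v → u ∈ D) (hφ : Set.InjOn φ D) (hSD : S ⊆ D)
    (hom : ∀ u v, G.Adj u v → H.Adj (φ u) (φ v))
    (lift : ∀ x y, H.Adj x y → ∃ u v, G.Adj u v ∧ φ u = x ∧ φ v = y) (hST : φ '' S = T) :
    AnchoredDecomposable H T ℓ m := by
  obtain ⟨K, hK, c, hc, hS⟩ := h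
  exact ⟨K, hK, _, hc.map φ D hD hφ hom lift, hS.map φ (hφ.mono hSD) hST⟩

theorem CycleDecomposable.map {V W : Type} {G : SimpleGraph V}
    {H : SimpleGraph W} {ℓ : ℕ} (h : CycleDecomposable G ℓ) (φ : V → W)
    (D : Set V) (hD : ∀ u v, G.Adj u v → u ∈ D) (hφ : Set.InjOn φ D)
    (hom : ∀ u v, G.Adj u v → H.Adj (φ u) (φ v))
    (lift : ∀ x y, H.Adj x y → ∃ u v, G.Adj u v ∧ φ u = x ∧ φ v = y) :
    CycleDecomposable H ℓ := by
  obtain ⟨K, hK, c, hc⟩ := h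
  exact ⟨K, hK, _, hc.map φ D hD hφ hom lift⟩

section PartialProduct

variable {ι : Type} [DecidableEq ι] {V : ι → Type} (G : ∀ j, SimpleGraph (V j))
  (S : ∀ j, Set (V j)) (o : ∀ j, V j)

/-- The anchors in the coordinates `s`, and a base point in the other coordinates. -/
def partialAnchors (s : Finset ι) (k : ι) : Set (V k) := if k ∈ s then S k else {o k}

/-- The anchored product of the factors in `s`, with the other coordinates fixed. -/
def partialProd (s : Finset ι) : SimpleGraph (∀ j, V j) where
  Adj u v := ∃ j ∈ s, (G j).Adj (u j) (v j) ∧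
    ∀ k, k ≠ j → u k = v k ∧ u k ∈ partialAnchors S o s k
  symm := ⟨by
    rintro u v ⟨j, hj, h, H⟩
    exact ⟨j, hj, h.symm, fun k hk => ⟨(H k hk).1.symm, (H k hk).1 ▸ (H k hk).2⟩⟩⟩
  loopless := ⟨by
    rintro u ⟨j, -, h, -⟩
    exact h.ne rfl⟩

/-- The tuples of anchors in the coordinates `s`. -/
def partialAnchorSet (s : Finset ι) : Set (∀ j, V j) := {u | ∀ k, u k ∈ partialAnchors S o s k}

variable {G S o}

theorem partialAnchors_insert_self (s : Finset ι) (j : ι) :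
    partialAnchors S o (insert j s) j = S j := if_pos (Finset.mem_insert_self j s)

theorem partialAnchors_insert_of_ne (s : Finset ι) {j k : ι} (h : k ≠ j) :
    partialAnchors S o (insert j s) k = partialAnchors S o s k := by
  simp only [partialAnchors, Finset.mem_insert, h, false_or]

theorem mem_partialAnchors_of_notMem {s : Finset ι} {k : ι} (h : k ∉ s) {x : V k} :
    x ∈ partialAnchors S o s k ↔ x = o k := by
  rw [partialAnchors, if_neg h, Set.mem_singleton_iff]

theorem partialAnchors_of_mem {s : Finset ι} {k : ι} (h : k ∈ s) :
    partialAnchors S o s k = S k := if_pos h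

theorem AnchoredDecomposable.partialProd_singleton {j : ι} {ℓ m : ℕ}
    (h : AnchoredDecomposable (G j) (S j) ℓ m) :
    AnchoredDecomposable (partialProd G S o {j}) (partialAnchorSet S o {j}) ℓ m := by
  have hk : ∀ {k : ι}, k ≠ j → k ∉ ({j} : Finset ι) := fun hk => by simpa using hk
  refine h.map (Function.update o j) Set.univ (fun _ _ _ => trivial)
    (Function.update_injective o j).injOn (Set.subset_univ _) (fun u v huv => ?_) ?_ ?_
  · refine ⟨j, Finset.mem_singleton_self j, by simpa using huv, fun k hkj => ?_⟩
    rw [Function.update_of_ne hkj, Function.update_of_ne hkj,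
      mem_partialAnchors_of_notMem (hk hkj)]
    exact ⟨rfl, rfl⟩
  · rintro x y ⟨i, hi, hxy, H⟩
    obtain rfl := Finset.mem_singleton.1 hi
    refine ⟨x i, y i, hxy, ?_, ?_⟩
    · rw [Function.update_eq_iff]
      exact ⟨rfl, fun k hki => ((mem_partialAnchors_of_notMem (hk hki)).1 (H k hki).2).symm⟩
    · rw [Function.update_eq_iff]
      refine ⟨rfl, fun k hki => ?_⟩
      rw [← (H k hki).1, (mem_partialAnchors_of_notMem (hk hki)).1 (H k hki).2]
  · ext u
    constructor
    · rintro ⟨x, hx, rfl⟩ k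
      by_cases hkj : k = j
      · subst hkj
        simpa [partialAnchors] using hx
      · rw [Function.update_of_ne hkj, mem_partialAnchors_of_notMem (hk hkj)]
    · intro hu
      refine ⟨u j, ?_, ?_⟩
      · simpa [partialAnchors] using hu j
      · rw [Function.update_eq_iff]
        exact ⟨rfl, fun k hkj => ((mem_partialAnchors_of_notMem (hk hkj)).1 (hu k)).symm⟩

section Insert

variable {s : Finset ι} {j : ι}

theorem boxAnch_partialProd_fst (hj : j ∉ s) (p q : (∀ j, V j) × V j)
    (h : (boxAnch (partialProd G S o s) (partialAnchorSet S o s) (G j) (S j)).Adj p q) :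
    p ∈ {p : (∀ j, V j) × V j | p.1 j = o j} := by
  rcases h with ⟨⟨i, hi, -, H⟩, -, -⟩ | ⟨-, -, h⟩
  · exact (mem_partialAnchors_of_notMem hj).1 (H j (fun e => hj (e ▸ hi))).2
  · exact (mem_partialAnchors_of_notMem hj).1 (h j)

/-- Updating forgets the coordinate `j` of the first component, which on this set is frozen at `o
j`. -/
theorem update_injOn (j : ι) :
    Set.InjOn (fun p : (∀ j, V j) × V j => Function.update p.1 j p.2)
      {p : (∀ j, V j) × V j | p.1 j = o j} := by
  rintro ⟨u, x⟩ hu ⟨v, y⟩ hv h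
  have h' : ∀ k, Function.update u j x k = Function.update v j y k := congrFun h
  refine Prod.ext (funext fun k => ?_) (by simpa using h' j)
  by_cases hk : k = j
  · subst hk
    exact Eq.trans hu (Eq.symm hv)
  · simpa [hk] using h' k

theorem boxAnch_partialProd_hom (hj : j ∉ s) (p q : (∀ j, V j) × V j)
    (h : (boxAnch (partialProd G S o s) (partialAnchorSet S o s) (G j) (S j)).Adj p q) :
    (partialProd G S o (insert j s)).Adj (Function.update p.1 j p.2)
      (Function.update q.1 j q.2) := by
  rcases h with ⟨⟨i, hi, hpq, H⟩, h₂, h₃⟩ | ⟨hpq, h₂, h₃⟩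
  · have hij : i ≠ j := fun e => hj (e ▸ hi)
    refine ⟨i, Finset.mem_insert_of_mem hi, by simpa [hij] using hpq, fun k hk => ?_⟩
    by_cases hkj : k = j
    · subst hkj
      rw [partialAnchors_insert_self]
      simpa using ⟨h₂, h₃⟩
    · rw [partialAnchors_insert_of_ne s hkj, Function.update_of_ne hkj, Function.update_of_ne hkj]
      exact H k hk
  · refine ⟨j, Finset.mem_insert_self j s, by simpa using hpq, fun k hk => ?_⟩
    rw [partialAnchors_insert_of_ne s hk, Function.update_of_ne hk, Function.update_of_ne hk]
    exact ⟨congrFun h₂ k, h₃ k⟩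

theorem exists_boxAnch_partialProd_adj (hj : j ∉ s) (x y : ∀ j, V j)
    (h : (partialProd G S o (insert j s)).Adj x y) :
    ∃ p q, (boxAnch (partialProd G S o s) (partialAnchorSet S o s) (G j) (S j)).Adj p q ∧
      Function.update p.1 j p.2 = x ∧ Function.update q.1 j q.2 = y := by
  obtain ⟨i, hi, hxy, H⟩ := h
  -- The coordinate `j` moves to the second factor, and the base point takes its place in the first.
  refine ⟨(Function.update x j (o j), x j), (Function.update y j (o j), y j), ?_, by simp, by simp⟩
  by_cases hij : i = j
  · subst hij
    refine Or.inr ⟨hxy, ?_, fun k => ?_⟩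
    · funext k
      by_cases hk : k = i
      · subst hk
        simp
      · simpa [hk] using (H k hk).1
    · by_cases hk : k = i
      · subst hk
        simp [mem_partialAnchors_of_notMem hj]
      · have := (H k hk).2
        rw [partialAnchors_insert_of_ne s hk] at this
        simpa [hk] using this
  · have hjj := H j (Ne.symm hij)
    rw [partialAnchors_insert_self] at hjj
    refine Or.inl ⟨⟨i, (Finset.mem_insert.1 hi).resolve_left hij, by simpa [hij] using hxy,
      fun k hk => ?_⟩, hjj.1, hjj.2⟩
    by_cases hkj : k = j
    · subst hkj
      simp [mem_partialAnchors_of_notMem hj]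
    · have := H k hk
      rw [partialAnchors_insert_of_ne s hkj] at this
      simpa [hkj] using this

theorem image_update_partialAnchorSet (hj : j ∉ s) :
    (fun p : (∀ j, V j) × V j => Function.update p.1 j p.2) '' (partialAnchorSet S o s ×ˢ S j) =
      partialAnchorSet S o (insert j s) := by
  ext u
  constructor
  · rintro ⟨⟨v, x⟩, ⟨hv, hx⟩, rfl⟩ k
    by_cases hk : k = j
    · subst hk
      rw [partialAnchors_insert_self]
      simpa using hx
    · rw [partialAnchors_insert_of_ne s hk]
      simpa [hk] using hv k
  · intro hu
    refine ⟨(Function.update u j (o j), u j), ⟨fun k => ?_, ?_⟩, by simp⟩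
    · by_cases hk : k = j
      · subst hk
        simp [mem_partialAnchors_of_notMem hj]
      · have := hu k
        rw [partialAnchors_insert_of_ne s hk] at this
        simpa [hk] using this
    · have := hu j
      rwa [partialAnchors_insert_self] at this

theorem AnchoredDecomposable.partialProd_insert (hj : j ∉ s) {ℓ m : ℕ}
    (h : AnchoredDecomposable
      (boxAnch (partialProd G S o s) (partialAnchorSet S o s) (G j) (S j))
      (partialAnchorSet S o s ×ˢ S j) ℓ m) :
    AnchoredDecomposable (partialProd G S o (insert j s)) (partialAnchorSet S o (insert j s))
      ℓ m :=
  h.map _ _ (boxAnch_partialProd_fst hj) (update_injOn j)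
    (fun _ hp => (mem_partialAnchors_of_notMem hj).1 (hp.1 j)) (boxAnch_partialProd_hom hj)
    (exists_boxAnch_partialProd_adj hj) (image_update_partialAnchorSet hj)

theorem CycleDecomposable.partialProd_insert (hj : j ∉ s) {ℓ : ℕ}
    (h : CycleDecomposable
      (boxAnch (partialProd G S o s) (partialAnchorSet S o s) (G j) (S j)) ℓ) :
    CycleDecomposable (partialProd G S o (insert j s)) ℓ :=
  h.map _ _ (boxAnch_partialProd_fst hj) (update_injOn j) (boxAnch_partialProd_hom hj)
    (exists_boxAnch_partialProd_adj hj)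

end Insert

/-- Starting with the factor `j₀`, the factors in `s` are added one by one, each with the smallest
or the largest possible growth of the cycles. -/
theorem anchoredDecomposable_partialProd {b t f : ι → ℕ} (hb : ∀ j, 0 < b j) (ht : ∀ j, 1 ≤ t j)
    (hbt : ∀ j, 3 ≤ 2 ^ t j * b j)
    (hG : ∀ j, AnchoredDecomposable (G j) (S j) (2 ^ t j * b j) (b j)) {j₀ : ι} (ht₀ : 2 ≤ t j₀)
    {s : Finset ι} (hs : j₀ ∉ s) (hf : ∀ j ∈ s, f j = 0 ∨ f j = t j - 1) :
    AnchoredDecomposable (partialProd G S o (insert j₀ s)) (partialAnchorSet S o (insert j₀ s))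
      (2 ^ (t j₀ + ∑ j ∈ s, f j) * ∑ j ∈ insert j₀ s, b j) (∑ j ∈ insert j₀ s, b j) := by
  induction s using Finset.induction_on with
  | empty => simpa using (hG j₀).partialProd_singleton
  | insert j s hj ih =>
    rw [Finset.mem_insert, not_or] at hs
    have ih := ih hs.2 fun k hk => hf k (Finset.mem_insert_of_mem hk)
    have hj' : j ∉ insert j₀ s := by
      rw [Finset.mem_insert, not_or]
      exact ⟨Ne.symm hs.1, hj⟩
    have hm : 0 < ∑ k ∈ insert j₀ s, b k :=
      Finset.sum_pos (fun k _ => hb k) (Finset.insert_nonempty _ _)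
    have he : 2 ^ 2 ≤ 2 ^ (t j₀ + ∑ k ∈ s, f k) := Nat.pow_le_pow_right (by norm_num) (by omega)
    have hpa : 3 ≤ 2 ^ (t j₀ + ∑ k ∈ s, f k) * ∑ k ∈ insert j₀ s, b k := by nlinarith
    have hp : Even (2 ^ (t j₀ + ∑ k ∈ s, f k)) := Nat.even_pow.2 ⟨even_two, by omega⟩
    have hq : Even (2 ^ t j) := Nat.even_pow.2 ⟨even_two, by have := ht j; omega⟩
    rw [Finset.insert_comm, Finset.sum_insert hj', Finset.sum_insert hj, add_comm (b j)]
    refine AnchoredDecomposable.partialProd_insert hj' (ih.box (hG j) ?_)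
    rcases hf j (Finset.mem_insert_self j s) with h | h
    · rw [h, zero_add]
      exact anchoredDecomposable_strips hp hq hm (hb j) hpa (hbt j)
    · rw [h, show t j₀ + (t j - 1 + ∑ k ∈ s, f k) = t j₀ + ∑ k ∈ s, f k + (t j - 1) by ring,
        pow_add 2 (t j₀ + ∑ k ∈ s, f k)]
      have e : 2 ^ t j = 2 * 2 ^ (t j - 1) := by
        rw [← pow_succ', Nat.sub_add_cancel (ht j)]
      have hbt := hbt j
      rw [e] at hbt ⊢
      exact anchoredDecomposable_spirals hp hm (hb j) hpa hbt

/-- Growth 0 comes from strips. For growth e ≥ 1, serpents with 2N = 2^e fit: `he` makes 4N = 2^(e +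
1) divide 2^t, and `hE` makes the other side of the torus divisible by 4. -/
theorem cycleDecomposable_box_pow {E t e a b : ℕ} (hE : 2 ≤ E) (ht : 1 ≤ t) (he : e ≤ t - 1)
    (ha : 0 < a) (hb : 0 < b) (hbt : 3 ≤ 2 ^ t * b) :
    CycleDecomposable (boxAnch (cyc (2 ^ E * a)) (multiples (2 ^ E * a) a)
      (cyc (2 ^ t * b)) (multiples (2 ^ t * b) b)) (2 ^ (E + e) * (a + b)) := by
  rcases e with _ | e
  · have h4 : 2 ^ 2 ≤ 2 ^ E := Nat.pow_le_pow_right (by norm_num) hE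
    exact (anchoredDecomposable_strips (Nat.even_pow.2 ⟨even_two, by omega⟩)
      (Nat.even_pow.2 ⟨even_two, by omega⟩) ha hb (by nlinarith) hbt).cycleDecomposable
  -- From here on the growth is `e + 1`, so that `N = 2 ^ e`.
  · obtain ⟨E, rfl⟩ := Nat.exists_eq_add_of_le hE
    obtain ⟨u, rfl⟩ : ∃ u, t = 2 + e + u := ⟨t - (2 + e), by omega⟩
    have h := cycleDecomposable_serpents (N := 2 ^ e) (P := 2 ^ E) (B := 2 ^ u) (a := a) (b := b)
      (by positivity) (by positivity) (by positivity) ha hb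
    rwa [show 4 * 2 ^ E = 2 ^ (2 + E) by ring, show 4 * 2 ^ e * 2 ^ u = 2 ^ (2 + e + u) by ring,
      show 2 ^ (2 + E) * (2 * 2 ^ e) = 2 ^ (2 + E + (e + 1)) by ring] at h

/-- Greedy filling: if `g` fits into the old indices, the new one receives 0; otherwise they are all
filled and the new one takes the remainder. -/
theorem exists_eq_sum_erase_add {s : Finset ι} (hs : s.Nonempty) (c : ι → ℕ) {g : ℕ}
    (hg : g ≤ ∑ j ∈ s, c j) :
    ∃ j ∈ s, ∃ (f : ι → ℕ) (e : ℕ), (∀ k ∈ s.erase j, f k = 0 ∨ f k = c k) ∧ e ≤ c j ∧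
      g = ∑ k ∈ s.erase j, f k + e := by
  induction hs using Finset.Nonempty.cons_induction with
  | singleton j => exact ⟨j, by simp, c, g, by simp, by simpa using hg, by simp⟩
  | cons j s hj hs ih =>
    rw [Finset.sum_cons] at hg
    simp only [Finset.cons_eq_insert]
    by_cases h : g ≤ ∑ k ∈ s, c k
    · obtain ⟨i, hi, f, e, hf, he, rfl⟩ := ih h
      have hij : j ≠ i := fun h => hj (h ▸ hi)
      have hji : j ∉ s.erase i := fun h => hj (Finset.mem_of_mem_erase h)
      refine ⟨i, Finset.mem_insert_of_mem hi, Function.update f j 0, e, fun k hk => ?_, he, ?_⟩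
      · rw [Finset.erase_insert_of_ne hij, Finset.mem_insert] at hk
        rcases hk with rfl | hk
        · simp
        · rw [Function.update_of_ne (ne_of_mem_of_not_mem hk hji)]
          exact hf k hk
      · rw [Finset.erase_insert_of_ne hij, Finset.sum_insert hji, Function.update_self, zero_add]
        congr 1
        exact Finset.sum_congr rfl fun k hk =>
          (Function.update_of_ne (ne_of_mem_of_not_mem hk hji) _ _).symm
    · refine ⟨j, Finset.mem_insert_self j s, c, g - ∑ k ∈ s, c k, fun _ _ => Or.inr rfl,
        by omega, ?_⟩
      rw [Finset.erase_insert hj]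
      omega

/-- The factor with intermediate growth is multiplied last, because serpents need not leave the
anchors equally spaced. The factors carry no order, so this factor may be any one other than `j₀`.
-/
theorem cycleDecomposable_partialProd [Fintype ι] {b t : ι → ℕ} (hb : ∀ j, 0 < b j)
    (ht : ∀ j, 1 ≤ t j) (hbt : ∀ j, 3 ≤ 2 ^ t j * b j)
    (hG : ∀ j, AnchoredDecomposable (G j) (S j) (2 ^ t j * b j) (b j)) {j₀ : ι} (ht₀ : 2 ≤ t j₀)
    (hne : (Finset.univ.erase j₀).Nonempty) {g : ℕ}
    (hg : g ≤ ∑ j ∈ Finset.univ.erase j₀, (t j - 1)) :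
    CycleDecomposable (partialProd G S o Finset.univ) (2 ^ (t j₀ + g) * ∑ j, b j) := by
  obtain ⟨j, hj, f, e, hf, he, rfl⟩ := exists_eq_sum_erase_add hne _ hg
  set s := (Finset.univ.erase j₀).erase j with hs
  have hjj : j ≠ j₀ := Finset.ne_of_mem_erase hj
  have hj' : j ∉ insert j₀ s := by simp [hs, hjj]
  have hu : insert j (insert j₀ s) = Finset.univ := by
    rw [Finset.insert_comm, hs, Finset.insert_erase hj, Finset.insert_erase (Finset.mem_univ _)]
  have h := anchoredDecomposable_partialProd (o := o) hb ht hbt hG ht₀ (s := s)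
    (by simp [hs]) hf
  rw [← hu, Finset.sum_insert hj', add_comm (b j), ← add_assoc]
  exact CycleDecomposable.partialProd_insert hj' (h.box_cycleDecomposable (hG j)
    (cycleDecomposable_box_pow (by omega) (ht j) he
      (Finset.sum_pos (fun k _ => hb k) (Finset.insert_nonempty _ _)) (hb j) (hbt j)))

/-- Non-isolated tuples of the full product have at most one coordinate off its anchor set. All
other tuples may be sent anywhere; here they go to `o`. -/
theorem CycleDecomposable.anchoredProd [Fintype ι] (ho : ∀ j, o j ∈ S j) {ℓ : ℕ}
    (h : CycleDecomposable (partialProd G S o Finset.univ) ℓ) :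
    CycleDecomposable (anchoredProd G S) ℓ := by
  classical
  have hD : ∀ u v, (partialProd G S o Finset.univ).Adj u v →
      u ∈ {v : ∀ j, V j | ∀ j k, j ≠ k → v j ∈ S j ∨ v k ∈ S k} := by
    rintro u v ⟨i, -, -, H⟩ j k hjk
    by_cases hi : j = i
    · right
      have := (H k (fun h => hjk (hi.trans h.symm))).2
      rwa [partialAnchors_of_mem (Finset.mem_univ k)] at this
    · left
      have := (H j hi).2
      rwa [partialAnchors_of_mem (Finset.mem_univ j)] at this
  have hval : ∀ u ∈ {v : ∀ j, V j | ∀ j k, j ≠ k → v j ∈ S j ∨ v k ∈ S k},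
      ((if h : ∀ j k, j ≠ k → u j ∈ S j ∨ u k ∈ S k then ⟨u, h⟩
        else ⟨o, fun j _ _ => Or.inl (ho j)⟩ : AnchoredVertex S)).1 = u := fun u hu =>
    congrArg Subtype.val (dif_pos hu)
  refine h.map (fun u => if h : ∀ j k, j ≠ k → u j ∈ S j ∨ u k ∈ S k then ⟨u, h⟩
    else ⟨o, fun j _ _ => Or.inl (ho j)⟩) _ hD ?_ ?_ ?_
  · intro u hu v hv e
    rw [← hval u hu, ← hval v hv]
    exact congrArg Subtype.val e
  · intro u v huv
    have hu := hval u (hD _ _ huv)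
    have hv := hval v (hD _ _ huv.symm)
    obtain ⟨j, -, h, H⟩ := huv
    refine ⟨j, ?_, fun k hk => ?_⟩
    · rw [hu, hv]
      exact h
    · rw [hu, hv]
      have := H k hk
      rwa [partialAnchors_of_mem (Finset.mem_univ k)] at this
  · rintro x y ⟨j, h, H⟩
    refine ⟨x.1, y.1, ⟨j, Finset.mem_univ j, h, fun k hk => ?_⟩, dif_pos x.2, dif_pos y.2⟩
    rw [partialAnchors_of_mem (Finset.mem_univ k)]
    exact H k hk

end PartialProduct

/-! ### From closed walks to subgraphs, and the theorem. -/

theorem IsCycleDecomp.cycleGraph_hom {V K : Type} {G : SimpleGraph V} {n : ℕ}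
    {c : K → ZMod (n + 3) → V} (hc : IsCycleDecomp G (n + 3) c) (k : K) {t t' : Fin (n + 3)}
    (h : (SimpleGraph.cycleGraph (n + 3)).Adj t t') : G.Adj (c k t) (c k t') := by
  rcases SimpleGraph.cycleGraph_adj.1 h with h | h
  · obtain rfl : t = t' + 1 := sub_eq_iff_eq_add'.1 h
    exact (hc.adj k t').symm
  · obtain rfl : t' = t + 1 := sub_eq_iff_eq_add'.1 h
    exact hc.adj k t

/-- The union must also contain all vertices, so none may be isolated; the existence of an edge also
makes the number of subgraphs positive. -/
theorem CycleDecomposable.decomposes {V : Type} [Nonempty V] {G : SimpleGraph V} {ℓ : ℕ}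
    (h : CycleDecomposable G ℓ) (hℓ : 3 ≤ ℓ) (hG : ∀ v, ∃ w, G.Adj v w) :
    Decomposes (SimpleGraph.cycleGraph ℓ) G := by
  obtain ⟨n, rfl⟩ : ∃ n, ℓ = n + 3 := ⟨ℓ - 3, by omega⟩
  obtain ⟨K, _, c, hc⟩ := h
  obtain ⟨N, ⟨e⟩⟩ := Finite.exists_equiv_fin K
  let f : K → SimpleGraph.Copy (SimpleGraph.cycleGraph (n + 3)) G := fun k =>
    ⟨⟨c k, hc.cycleGraph_hom k⟩, hc.inj k⟩
  have hadj : ∀ {k u v}, (f k).toSubgraph.Adj u v ↔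
      ∃ t, s(c k t, c k (t + 1)) = s(u, v) := fun {k u v} => by
    constructor
    · rintro ⟨t, t', h, rfl, rfl⟩
      rcases SimpleGraph.cycleGraph_adj.1 h with h | h
      · obtain rfl : t = t' + 1 := sub_eq_iff_eq_add'.1 h
        exact ⟨t', Sym2.eq_swap⟩
      · obtain rfl : t' = t + 1 := sub_eq_iff_eq_add'.1 h
        exact ⟨t, rfl⟩
    · rintro ⟨t, h⟩
      have ht : (f k).toSubgraph.Adj (c k t) (c k (t + 1)) :=
        ⟨t, (t + 1 : ZMod (n + 3)),
          SimpleGraph.cycleGraph_adj.2 (Or.inr (add_sub_cancel_left (G := Fin (n + 3)) t 1)),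
          rfl, rfl⟩
      rwa [← SimpleGraph.Subgraph.mem_edgeSet, h, SimpleGraph.Subgraph.mem_edgeSet] at ht
  have hsup : ∀ {u v}, G.Adj u v → (⨆ r, (f (e.symm r)).toSubgraph).Adj u v := fun {u v} huv => by
    obtain ⟨k, t, hkt⟩ := hc.edge_surj u v huv
    exact SimpleGraph.Subgraph.iSup_adj.2 ⟨e k, hadj.2 ⟨t, by simpa using hkt⟩⟩
  refine ⟨N, fun r => (f (e.symm r)).toSubgraph, ?_, fun r => ⟨(f _).isoToSubgraph⟩,
    fun r s hrs => ?_, ?_⟩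
  · obtain ⟨v⟩ := ‹Nonempty V›
    obtain ⟨w, hvw⟩ := hG v
    obtain ⟨k, -⟩ := hc.edge_surj v w hvw
    exact (e k).pos
  · rw [Set.disjoint_left]
    refine Sym2.ind fun u v h₁ h₂ => hrs ?_
    obtain ⟨t, ht⟩ := hadj.1 h₁
    obtain ⟨t', ht'⟩ := hadj.1 h₂
    exact e.symm.injective (hc.edge_inj _ _ _ _ (ht.trans ht'.symm)).1
  · refine SimpleGraph.Subgraph.ext ?_ ?_
    · refine Set.eq_univ_of_forall fun v => ?_
      obtain ⟨w, hvw⟩ := hG v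
      exact (hsup hvw).fst_mem
    · funext u v
      exact propext ⟨fun h => h.adj_sub, fun h => hsup h⟩

/-- A vertex can move in its coordinate off the anchors, or in any coordinate if there is none. -/
theorem anchoredProd_exists_adj {ι : Type} [Nonempty ι] {V : ι → Type}
    {G : ∀ j, SimpleGraph (V j)} {S : ∀ j, Set (V j)} (hG : ∀ j v, ∃ w, (G j).Adj v w)
    (v : AnchoredVertex S) : ∃ w, (anchoredProd G S).Adj v w := by
  classical
  obtain ⟨j, hj⟩ : ∃ j, ∀ k, k ≠ j → v.1 k ∈ S k := by
    by_cases h : ∃ j, v.1 j ∉ S j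
    · obtain ⟨j, hj⟩ := h
      exact ⟨j, fun k hk => (v.2 k j hk).resolve_right hj⟩
    · push Not at h
      exact ⟨Classical.arbitrary ι, fun k _ => h k⟩
  obtain ⟨w, hw⟩ := hG j (v.1 j)
  have hmem : ∀ k, k ≠ j → Function.update v.1 j w k ∈ S k := fun k hk => by
    rw [Function.update_of_ne hk]
    exact hj k hk
  refine ⟨⟨Function.update v.1 j w, fun k l hkl => ?_⟩, j, ?_, fun k hk => ⟨?_, hj k hk⟩⟩
  · by_cases hk : k = j
    · exact Or.inr (hmem l fun hl => hkl (hk.trans hl.symm))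
    · exact Or.inl (hmem k hk)
  · simpa using hw
  · exact (Function.update_of_ne hk _ _).symm

theorem cycleGraph_exists_adj {y : ℕ} (hy : 2 ≤ y) (v : Fin y) :
    ∃ w, (SimpleGraph.cycleGraph y).Adj v w := by
  obtain ⟨n, rfl⟩ : ∃ n, y = n + 2 := ⟨y - 2, by omega⟩
  exact ⟨v + 1, SimpleGraph.cycleGraph_adj.2 (Or.inr (add_sub_cancel_left v 1))⟩

theorem lemma6 (d a α : ℕ) (i y z : ℕ → ℕ) (hd : 2 ≤ d)
    (hi : ∀ j ∈ Finset.Icc 1 d, ∀ k ∈ Finset.Icc 1 d, j < k → i k < i j)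
    (hid : i d = 0)
    (ha : a = ∑ j ∈ Finset.Icc 1 d, 2 ^ i j)
    (hy : ∀ j ∈ Finset.Icc 1 d, 4 ≤ y j ∧ ∃ e : ℕ, y j = 2 ^ e)
    (hz : ∀ j ∈ Finset.Icc 1 d, y j = z j * 2 ^ i j)
    (hzeven : ∀ j ∈ Finset.Icc 1 d, Even (z j))
    (hα₁ : alphaMax d z 1 ≤ α)
    (hαd : α ≤ alphaMax d z d)
    (hdvdd : 4 ∣ y d)
    (hdvd₁ : A3 d z α * 2 ^ i 1 ∣ y 1)
    (hdvd : ∀ j ∈ Finset.Icc 2 (d - 1), AFactor d z α (j + 2) * 2 ^ (i j + 1) ∣ y j) :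
    Decomposes (SimpleGraph.cycleGraph (a * 2 ^ α))
      (anchoredProd (fun j : Finset.Icc 1 d => SimpleGraph.cycleGraph (y j))
        (fun j : Finset.Icc 1 d => everyNth (y j) (2 ^ i j))) := by
  have hz2 : ∀ j ∈ Finset.Icc 1 d, z j = 2 ^ Nat.log 2 (z j) ∧ 1 ≤ Nat.log 2 (z j) := by
    intro j hj
    obtain ⟨h4, e, he⟩ := hy j hj
    obtain ⟨t, -, ht⟩ := (Nat.dvd_prime_pow Nat.prime_two).1 (Dvd.intro _ ((hz j hj).symm.trans he))
    rw [ht, Nat.log_pow one_lt_two]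
    refine ⟨rfl, Nat.one_le_iff_ne_zero.2 fun h0 => ?_⟩
    have := hzeven j hj
    rw [ht, h0] at this
    simp at this
  have hdmem : d ∈ Finset.Icc 1 d := Finset.mem_Icc.2 ⟨by omega, le_rfl⟩
  have h1mem : 1 ∈ Finset.Icc 1 d := Finset.mem_Icc.2 ⟨le_rfl, by omega⟩
  let j₀ : Finset.Icc 1 d := ⟨d, hdmem⟩
  have : Nonempty (Finset.Icc 1 d) := ⟨j₀⟩
  have hyt : ∀ j : Finset.Icc 1 d, y j = 2 ^ Nat.log 2 (z j) * 2 ^ i j := fun j => by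
    rw [← (hz2 j j.2).1, ← hz j j.2]
  have ht₀ : 2 ≤ Nat.log 2 (z d) := by
    have h := (hy d hdmem).1
    rw [hz d hdmem, hid, pow_zero, mul_one] at h
    exact (Nat.le_log_iff_pow_le one_lt_two (by omega)).2 h
  -- Since α_1 = log₂ z_d, the difference `g` is the growth to be distributed over the other
  -- factors.
  have hα : Nat.log 2 (z d) ≤ α := by simpa [alphaMax] using hα₁
  obtain ⟨g, rfl⟩ := Nat.exists_eq_add_of_le hα
  -- Every logarithm is at least 1, so subtracting `d - 1` from the sum amounts to subtracting 1
  -- from each term, without truncation.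
  have hsum : ∑ j ∈ Finset.Icc 1 (d - 1), (Nat.log 2 (z j) - 1) + (d - 1) =
      ∑ j ∈ Finset.Icc 1 (d - 1), Nat.log 2 (z j) := by
    have hone : ∑ j ∈ Finset.Icc 1 (d - 1), 1 = d - 1 := by simp
    nth_rewrite 2 [← hone]
    rw [← Finset.sum_add_distrib]
    refine Finset.sum_congr rfl fun j hj => Nat.sub_add_cancel (hz2 j ?_).2
    rw [Finset.mem_Icc] at hj ⊢
    omega
  have hg : g ≤ ∑ j ∈ Finset.univ.erase j₀, (Nat.log 2 (z j) - 1) := by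
    have h₁ : Nat.log 2 (z d) - 1 + ∑ j ∈ Finset.univ.erase j₀, (Nat.log 2 (z j) - 1) =
        ∑ j : Finset.Icc 1 d, (Nat.log 2 (z j) - 1) :=
      Finset.add_sum_erase Finset.univ (fun j : Finset.Icc 1 d => Nat.log 2 (z j) - 1)
        (Finset.mem_univ j₀)
    rw [Finset.sum_coe_sort (Finset.Icc 1 d) fun j => Nat.log 2 (z j) - 1] at h₁
    have h₂ := Finset.sum_Icc_succ_top (a := 1) (b := d - 1) (by omega)
      fun j => Nat.log 2 (z j) - 1
    rw [Nat.sub_add_cancel (by omega : 1 ≤ d)] at h₂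
    rw [alphaMax] at hαd
    omega
  have hy0 : ∀ j : Finset.Icc 1 d, NeZero (y j) := fun j => ⟨by have := (hy j j.2).1; omega⟩
  have key := cycleDecomposable_partialProd
    (G := fun j : Finset.Icc 1 d => SimpleGraph.cycleGraph (y j))
    (S := fun j : Finset.Icc 1 d => everyNth (y j) (2 ^ i j)) (o := fun j => 0)
    (b := fun j => 2 ^ i j) (t := fun j => Nat.log 2 (z j)) (fun j => by positivity)
    (fun j => (hz2 j j.2).2) (fun j => by rw [← hyt]; have := (hy j j.2).1; omega)
    (fun j => anchoredDecomposable_cycleGraph _ (hyt j) (by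
      rw [← hyt]; have := (hy j j.2).1; omega)) (j₀ := j₀) ht₀
    ⟨⟨1, h1mem⟩, Finset.mem_erase.2 ⟨fun h => by
      have := congrArg Subtype.val h; simp [j₀] at this; omega, Finset.mem_univ _⟩⟩ hg
  have ho : ∀ j : Finset.Icc 1 d, (0 : Fin (y j)) ∈ everyNth (y j) (2 ^ i j) := fun j => by
    simp [everyNth]
  have hsum_eq : a = ∑ j : Finset.Icc 1 d, 2 ^ i j := by
    rw [ha, Finset.sum_coe_sort (Finset.Icc 1 d) fun j => 2 ^ i j]
  have : Nonempty (AnchoredVertex fun j : Finset.Icc 1 d => everyNth (y j) (2 ^ i j)) :=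
    ⟨⟨fun j => 0, fun j _ _ => Or.inl (ho j)⟩⟩
  rw [hsum_eq, mul_comm]
  refine (CycleDecomposable.anchoredProd ho key).decomposes ?_
    (anchoredProd_exists_adj fun j => cycleGraph_exists_adj (by have := (hy j j.2).1; omega))
  have hpos : 0 < ∑ j : Finset.Icc 1 d, 2 ^ i j :=
    Finset.sum_pos (fun j _ => by positivity) Finset.univ_nonempty
  have h4 : 2 ^ 2 ≤ 2 ^ (Nat.log 2 (z d) + g) := Nat.pow_le_pow_right (by norm_num) (by omega)
  nlinarith
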